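/- **Setting.** A complex random variable $X$ is subgaussian with parameter $K$ if $\inf\{t>0:\ \mathbb{E}\exp(|X|^2/t^2)\le 2\}\le K<\infty$. Let $\xi=(\xi_1,\dots,\xi_n)\in\mathbb{C}^n$ be a random vector whose entries are i.i.d. and subgaussian with parameter $K$, with $\mathbb{E}\,\xi_j=0$ and $\mathbb{E}|\xi_j|^2=1$, and let $\xi^{(1)},\dots,\xi^{(m)}$ be independent copies of $\xi$. For Hermitian $Z\in\mathbb{C}^{n\times n}$ put $\mathcal{A}(Z)_i=\operatorname{Tr}\big(\xi^{(i)}(\xi^{(i)})^*Z\big)$, $i=1,\dots,m$, and let $\|Z\|_1$ be the sum of the absolute values of the eigenvalues of $Z$ (with multiplicity). For a signal $x_0\in\mathbb{R}^n$ and noise $w\in\mathbb{R}^m$, let $y_i=|\langle \xi^{(i)},x_0\rangle|^2+w_i$, and call $\hat X$ a solution of the real PhaseLift program if it minimizes $\|\mathcal{A}(X)-y\|_{\ell_1}$ over all real symmetric positive semidefinite $X\in\mathbb{R}^{n\times n}$. **Theorem.** There are universal constants $C_0,C_1,C_2,C_3>0$ such that, for all $n$, $m$, $K$ and $\xi$ as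 above, the following two statements hold. 1. If $m\ge C_1K^{20}n$, then with probability at least $1-C_0\exp\!\big(-\tfrac{m}{C_2K^{16}}\big)$ the following is true: for all $x_0\in\mathbb{R}^n\setminus\{0\}$ with $\|x_0\|_\infty\le\frac1{81}\|x_0\|$ and all $w\in\mathbb{R}^m$, every solution $\hat X$ of the real PhaseLift program satisfies $$\|\hat X-x_0x_0^*\|_1\le C_3\,\frac{K^8}{m}\,\|w\|_{\ell_1}.$$ 2. If moreover $\mathbb{E}|\xi_1|^4\ge 1+\beta$ for some $\beta\in(0,1]$, and $m\ge C_1\frac{K^{20}}{\beta^{5/2}}n$, then with probability at least $1-C_0\exp\!\big(-\tfrac{m\beta^4}{C_2K^{16}}\big)$ the following is true: for all $x_0\in\mathbb{R}^n\setminus\{0\}$ and all $w\in\mathbb{R}^m$, every solution $\hat X$ of the real PhaseLift program satisfies $$\|\hat X-x_0x_0^*\|_1\le C_3\,\frac{K^8}{m\,\beta^{5/2}}\,\|w\|_{\ell_1}.$$ -/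

import Mathlib

open MeasureTheory ProbabilityTheory
open scoped ENNReal Matrix ComplexOrder

noncomputable section

namespace PhaseLift

/-- The subgaussian norm `inf {t > 0 : E exp(|X|² / t²) ≤ 2}` of a complex random variable, with
values in `[0, ∞]`; it is `∞` if there is no such `t`. -/
def psiTwoNorm {Ω : Type*} [MeasurableSpace Ω] (X : Ω → ℂ) (P : Measure Ω) : ℝ≥0∞ :=
  sInf (ENNReal.ofReal ''
    {t : ℝ | 0 < t ∧ ∫⁻ ω, ENNReal.ofReal (Real.exp (‖X ω‖ ^ 2 / t ^ 2)) ∂P ≤ 2})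

/-- `X` is subgaussian with parameter `K`. -/
def IsSubgaussian {Ω : Type*} [MeasurableSpace Ω] (X : Ω → ℂ) (K : ℝ) (P : Measure Ω) : Prop :=
  psiTwoNorm X P ≤ ENNReal.ofReal K

/-- A random vector in `ℂⁿ` whose entries are i.i.d. subgaussian with parameter `K`, have
expectation `0`, and satisfy `E |ζ_j|² = 1`. -/
structure IsSubgaussianVector {n : ℕ} {Ω : Type*} [MeasurableSpace Ω]
    (ζ : Ω → EuclideanSpace ℂ (Fin n)) (K : ℝ) (P : Measure Ω) : Prop where
  measurable : Measurable ζ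
  indep : iIndepFun (fun (j : Fin n) (ω : Ω) => ζ ω j) P
  identDistrib : ∀ j k : Fin n, IdentDistrib (fun ω => ζ ω j) (fun ω => ζ ω k) P P
  mean : ∀ j, ∫ ω, ζ ω j ∂P = 0
  variance : ∀ j, ∫ ω, ‖ζ ω j‖ ^ 2 ∂P = 1
  subgaussian : ∀ j, IsSubgaussian (fun ω => ζ ω j) K P

/-- `ξ 0, …, ξ (m - 1)`, defined on `(Ω, P)`, are independent copies of the random vector `ζ`,
defined on `(Ω₀, P₀)`. -/
structure AreIndepCopies {n m : ℕ} {Ω₀ Ω : Type*} [MeasurableSpace Ω₀] [MeasurableSpace Ω]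
    (ξ : Fin m → Ω → EuclideanSpace ℂ (Fin n)) (P : Measure Ω)
    (ζ : Ω₀ → EuclideanSpace ℂ (Fin n)) (P₀ : Measure Ω₀) : Prop where
  measurable : ∀ i, Measurable (ξ i)
  indep : iIndepFun ξ P
  identDistrib : ∀ i, IdentDistrib (ξ i) ζ P P₀

/-- The rank one matrix `x x*`. -/
def lift {n : ℕ} (x : EuclideanSpace ℂ (Fin n)) : Matrix (Fin n) (Fin n) ℂ :=
  Matrix.vecMulVec x.ofLp (star x.ofLp)

/-- The lifted measurement operator, `𝒜(Z)(i) = ⟨ξᵢ ξᵢ*, Z⟩ = Tr ((ξᵢ ξᵢ*)* Z)`. This trace is a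
real number for every Hermitian `Z`, so that taking the real part only changes its type. -/
def measOp {n m : ℕ} (ξ : Fin m → EuclideanSpace ℂ (Fin n)) (Z : Matrix (Fin n) (Fin n) ℂ)
    (i : Fin m) : ℝ :=
  ((lift (ξ i))ᴴ * Z).trace.re

/-- The noisy phaseless observations `y_i = |⟨ξᵢ, x⟩|² + w_i`. -/
def observations {n m : ℕ} (ξ : Fin m → EuclideanSpace ℂ (Fin n)) (x : EuclideanSpace ℂ (Fin n))
    (w : Fin m → ℝ) (i : Fin m) : ℝ :=
  ‖inner ℂ (ξ i) x‖ ^ 2 + w i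

/-- The `ℓ₁` norm on `ℝᵐ`. -/
def l1Norm {m : ℕ} (v : Fin m → ℝ) : ℝ := ∑ i, |v i|

/-- The positive semidefinite Hermitian `n × n` matrices all of whose entries are real. -/
def realPSD (n : ℕ) : Set (Matrix (Fin n) (Fin n) ℂ) :=
  {X | X.PosSemidef ∧ ∀ i j, (X i j).im = 0}

/-- `X` is a solution of the program: minimize `‖𝒜(X) - y‖₁` over the real positive semidefinite
matrices. -/
def IsRealPhaseLiftSolution {n m : ℕ} (ξ : Fin m → EuclideanSpace ℂ (Fin n)) (y : Fin m → ℝ)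
    (X : Matrix (Fin n) (Fin n) ℂ) : Prop :=
  X ∈ realPSD n ∧ IsMinOn (fun W => l1Norm (measOp ξ W - y)) (realPSD n) X

/-- The Schatten 1-norm of a Hermitian matrix: the sum of the absolute values of its eigenvalues,
counted with multiplicity. -/
def schattenOneNorm {n : ℕ} (Z : Matrix (Fin n) (Fin n) ℂ) : ℝ :=
  (Z.charpoly.roots.map (fun z => ‖z‖)).sum

theorem schattenOneNorm_eq {n : ℕ} {Z : Matrix (Fin n) (Fin n) ℂ} (hZ : Z.IsHermitian) :
    schattenOneNorm Z = ∑ i, |hZ.eigenvalues i| := by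
  rw [schattenOneNorm, hZ.roots_charpoly_eq_eigenvalues, Multiset.map_map]
  exact Finset.sum_congr rfl fun i _ => by simp

/-- The vectors of `ℂⁿ` with real entries. -/
def realSignals (n : ℕ) : Set (EuclideanSpace ℂ (Fin n)) := {x | ∀ j, (x j).im = 0}

/-- The nonzero signals with `‖x‖_∞ ≤ μ ‖x‖`; the norm of `x.ofLp : Fin n → ℂ` is the sup norm. -/
def flatSignals (n : ℕ) (μ : ℝ) : Set (EuclideanSpace ℂ (Fin n)) :=
  {x | x ≠ 0 ∧ ‖x.ofLp‖ ≤ μ * ‖x‖}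

end PhaseLift

end

/-!
Write `Y_H(x) = x* H x`. For a solution `X` of the program the error `H = X - x₀ x₀*` satisfies
`∑ i, |Y_H(ξᵢ)| ≤ 2 ‖w‖₁`, by comparison with the feasible point `x₀ x₀*`
(`sum_abs_quadForm_sub_lift_le`). Hence it suffices to bound `(1 / m) ∑ i, |Y_H(ξᵢ)|` from below
by a multiple of the trace norm `‖H‖₁`, uniformly over all such descent directions `H`.

*Second moments.* For a vector `Z` with i.i.d. standardized entries the variables
`Re (conj Z_j * Z_k) - δ_jk` are orthogonal up to the symmetry in `(j, k)`, so for real symmetric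
`H` the second moment `E Y_H²` is at least `(tr H)²` plus the squared off-diagonal Frobenius norm
plus `E |Z₁|⁴ - 1` times the squared norm of the diagonal (`le_integral_sq_sum`).

*Descent directions.* `H = X - x₀ x₀*` has at most one negative eigenvalue, so either
`tr H ≥ ‖H‖₁ / 3`, or an eigenvalue is at most `-‖H‖₁ / 3`
(`trace_ge_or_exists_eigenvalue_le`). In the latter case the Frobenius norm of `H` is at least
`‖H‖₁ / 3`, which is enough if `E |Z₁|⁴ ≥ 1 + β`. If `x₀` is flat, the standard basis vectors are
almost orthogonal to `x₀`, which makes the diagonal of `H` almost nonnegative; the negative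
eigenvalue then has to come from the off-diagonal part (`sq_sum_abs_eigenvalues_le_of_flat`). In
all cases `E Y_H² ≥ (b⁴ / 16) ‖H‖₁²`, with `b = 1` for flat signals and `b = β ^ (1 / 4)` in
general.

*First moments.* Since `|y| ≥ y² / t - y⁶ / t⁵`, the bound `E Y_H⁶ ≲ K¹² ‖H‖₁⁶` turns this into
`E |Y_H| ≳ b⁵ K⁻³ ‖H‖₁`. Using the sixth moment gives exactly the exponent `5 / 2` of `β`
required of the number of measurements, which is of order `n / (E |Y_H|)²` up to powers of `K`.

*Uniformity.* Let `H` range over a countable set of matrices of trace norm one. Symmetrization and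
contraction, carried out for one summand and then tensorized, give
`E sup_H exp (a ∑ i, (E |Y_H| - |Y_H(ξᵢ)|)) ≤ E sup_H exp (2 a ∑ i, εᵢ Y_H(ξᵢ))` with random signs
`εᵢ` (`lintegral_iSup_exp_integral_abs_sub_le`, `lintegral_iSup_exp_sum_le`). On the right-hand side
the sum is at most a constant times the largest of the values `± ∑ i, εᵢ |⟪ξᵢ, v⟫|²` with `v` in a
`1 / 2`-net of the unit sphere (`abs_signedForm_le_of_net`), whose exponential moments are
controlled because `⟪ξᵢ, v⟫` is subgaussian (`lintegral_exp_norm_sq_inner_le`).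
Markov's inequality yields the probability bound (`measure_exists_sum_abs_lt_le`), and density of the countable set extends the lower bound to all
`H` (`exists_measurableSet_forall_le_sum_abs`).
-/

namespace PhaseLift

/-! ### Scalar inequalities -/

theorem exp_le_id_add_exp_sq (x : ℝ) : Real.exp x ≤ x + Real.exp (x ^ 2) := by
  have h1 := Real.add_one_le_exp (x ^ 2)
  rcases le_or_gt |x| 1 with h | h
  · have := (abs_le.1 (Real.abs_exp_sub_one_sub_id_le h)).2
    linarith
  · rcases lt_abs.1 h with h | h
    · have : Real.exp x ≤ Real.exp (x ^ 2) := Real.exp_le_exp.2 (by nlinarith)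
      linarith
    · have : Real.exp x ≤ 1 := Real.exp_le_one_iff.2 (by linarith)
      nlinarith

theorem exp_mul_le_one_add {θ : ℝ} (h0 : 0 ≤ θ) (h1 : θ ≤ 1) (y : ℝ) :
    Real.exp (θ * y) ≤ 1 + θ * (Real.exp y - 1) := by
  have := convexOn_exp.2 (Set.mem_univ y) (Set.mem_univ 0) h0 (sub_nonneg.2 h1) (by ring)
  simp only [smul_eq_mul, mul_zero, add_zero, Real.exp_zero, mul_one] at this
  linarith

theorem cosh_mul_le_one_add {θ w : ℝ} (h0 : 0 ≤ θ) (h1 : θ ≤ 1) (hw : 0 ≤ w) :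
    Real.cosh (θ * w) ≤ 1 + θ ^ 2 * Real.exp w := by
  have hA := Real.hasSum_cosh (θ * w)
  have hB := (hasSum_ite_eq (0 : ℕ) (1 : ℝ)).add ((Real.hasSum_cosh w).mul_left (θ ^ 2))
  have h : Real.cosh (θ * w) ≤ 1 + θ ^ 2 * Real.cosh w := by
    refine hasSum_le (fun k => ?_) hA hB
    rcases Nat.eq_zero_or_pos k with rfl | hk
    · simpa using sq_nonneg θ
    · have : θ ^ (2 * k) ≤ θ ^ 2 := pow_le_pow_of_le_one h0 h1 (by omega)
      simp only [hk.ne', if_false, zero_add, mul_pow, mul_div_assoc]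
      gcongr
  have h2 : Real.cosh w ≤ Real.exp w := by
    rw [Real.cosh_eq]
    have : Real.exp (-w) ≤ Real.exp w := Real.exp_le_exp.2 (by linarith)
    linarith
  nlinarith [sq_nonneg θ]

/-- A lower bound for the absolute value by a polynomial: together with an upper bound for the
sixth moment it turns a lower bound for the second moment into one for the first moment. -/
theorem sq_div_sub_pow_div_le_abs {t : ℝ} (ht : 0 < t) (y : ℝ) :
    y ^ 2 / t - y ^ 6 / t ^ 5 ≤ |y| := by
  have e : y ^ 2 / t - y ^ 6 / t ^ 5 = (|y| ^ 2 * t ^ 4 - |y| ^ 6) / t ^ 5 := by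
    rw [sq_abs, show |y| ^ 6 = (|y| ^ 2) ^ 3 by ring, sq_abs]
    field_simp
  rw [e, div_le_iff₀ (by positivity)]
  have ha := abs_nonneg y
  generalize |y| = a at ha
  rcases le_total a t with h | h
  · have : a ^ 2 * t ^ 4 ≤ a * t ^ 5 := by
      have := mul_le_mul_of_nonneg_left h (by positivity : 0 ≤ a * t ^ 4)
      linarith
    have : 0 ≤ a ^ 6 := by positivity
    linarith
  · have h4 : t ^ 4 ≤ a ^ 4 := by gcongr
    have := mul_le_mul_of_nonneg_left h4 (by positivity : 0 ≤ a ^ 2)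
    have : 0 ≤ a * t ^ 5 := by positivity
    nlinarith

/-! ### Linear functionals of a subgaussian vector -/

section Subgaussian

variable {Ω : Type*} [MeasurableSpace Ω] {P : Measure Ω} [IsProbabilityMeasure P]

/-- The moment generating function of a centred subgaussian variable. For small `c` this follows from
`exp_le_id_add_exp_sq`, where the linear term integrates to zero; for large `c` from
`2 * x * y ≤ x ^ 2 + y ^ 2`. -/
theorem lintegral_exp_re_mul_le {X : Ω → ℂ} (hX : Measurable X) (h0 : ∫ ω, X ω ∂P = 0) {L : ℝ}
    (hL : 0 < L) (hexp : ∫⁻ ω, ENNReal.ofReal (Real.exp (‖X ω‖ ^ 2 / L ^ 2)) ∂P ≤ 2) (c : ℂ) :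
    ∫⁻ ω, ENNReal.ofReal (Real.exp (c * X ω).re) ∂P
      ≤ ENNReal.ofReal (Real.exp (‖c‖ ^ 2 * L ^ 2)) := by
  have hm : Measurable fun ω => Real.exp (‖X ω‖ ^ 2 / L ^ 2) := by fun_prop
  have hI : Integrable (fun ω => Real.exp (‖X ω‖ ^ 2 / L ^ 2)) P := by
    refine ⟨hm.aestronglyMeasurable, ?_⟩
    rw [hasFiniteIntegral_iff_ofReal (ae_of_all _ fun _ => (Real.exp_pos _).le)]
    exact hexp.trans_lt (by simp)
  have hI2 : ∫ ω, Real.exp (‖X ω‖ ^ 2 / L ^ 2) ∂P ≤ 2 := by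
    rw [integral_eq_lintegral_of_nonneg_ae (ae_of_all _ fun _ => (Real.exp_pos _).le)
      hm.aestronglyMeasurable]
    exact ENNReal.toReal_le_of_le_ofReal (by norm_num) (by simpa using hexp)
  have hXI : Integrable X P := by
    refine (hI.const_mul L).mono' hX.aestronglyMeasurable (ae_of_all _ fun ω => ?_)
    have h1 := Real.add_one_le_exp (‖X ω‖ ^ 2 / L ^ 2)
    have h2 : ‖X ω‖ / L ≤ ‖X ω‖ ^ 2 / L ^ 2 + 1 := by
      rw [← div_pow]; nlinarith [sq_nonneg (‖X ω‖ / L - 1)]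
    calc ‖X ω‖ = L * (‖X ω‖ / L) := by field_simp
      _ ≤ L * Real.exp (‖X ω‖ ^ 2 / L ^ 2) := by gcongr; exact h2.trans h1
  have hlinI : ∀ a b : ℝ,
      Integrable (fun ω => a + b * (Real.exp (‖X ω‖ ^ 2 / L ^ 2) - 1)) P := fun a b =>
    (integrable_const a).add ((hI.sub (integrable_const 1)).const_mul b)
  have hlin : ∀ a b : ℝ, 0 ≤ b →
      ∫ ω, (a + b * (Real.exp (‖X ω‖ ^ 2 / L ^ 2) - 1)) ∂P ≤ a + b := fun a b hb => by
    have hs : Integrable (fun ω => b * (Real.exp (‖X ω‖ ^ 2 / L ^ 2) - 1)) P :=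
      (hI.sub (integrable_const 1)).const_mul b
    rw [integral_add (integrable_const a) hs, integral_const_mul,
      integral_sub hI (integrable_const 1)]
    simp only [integral_const, probReal_univ, smul_eq_mul, mul_one]
    nlinarith
  have hre : ∀ ω, (c * X ω).re ≤ ‖c‖ * ‖X ω‖ := fun ω =>
    (Complex.re_le_norm _).trans (norm_mul_le _ _)
  have hre' : ∀ ω, (c * X ω).re ^ 2 ≤ (‖c‖ * L) ^ 2 * (‖X ω‖ ^ 2 / L ^ 2) := fun ω => by
    have h1 : |(c * X ω).re| ≤ ‖c‖ * ‖X ω‖ := (Complex.abs_re_le_norm _).trans (norm_mul_le _ _)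
    have h2 : (‖c‖ * L) ^ 2 * (‖X ω‖ ^ 2 / L ^ 2) = (‖c‖ * ‖X ω‖) ^ 2 := by field_simp
    rw [h2, ← sq_abs]
    gcongr
  rw [← mul_pow]
  set s := ‖c‖ * L with hs
  have hs0 : 0 ≤ s := by positivity
  -- Both regimes dominate the integrand by an integrable function with an explicit integral.
  have key : ∀ g : Ω → ℝ, Integrable g P → (∀ ω, Real.exp (c * X ω).re ≤ g ω) →
      ∫ ω, g ω ∂P ≤ Real.exp (s ^ 2) → ∫⁻ ω, ENNReal.ofReal (Real.exp (c * X ω).re) ∂P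
      ≤ ENNReal.ofReal (Real.exp (s ^ 2)) := by
    intro g hg hle hint
    calc _ ≤ ∫⁻ ω, ENNReal.ofReal (g ω) ∂P :=
          lintegral_mono fun ω => ENNReal.ofReal_le_ofReal (hle ω)
      _ = ENNReal.ofReal (∫ ω, g ω ∂P) := (ofReal_integral_eq_lintegral_ofReal hg
          (ae_of_all _ fun ω => (Real.exp_pos _).le.trans (hle ω))).symm
      _ ≤ _ := ENNReal.ofReal_le_ofReal hint
  rcases le_or_gt s 1 with h | h
  · have hs2 : s ^ 2 ≤ 1 := by nlinarith
    have hcX : Integrable (fun ω => (c * X ω).re) P := (hXI.const_mul c).re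
    have hcX0 : ∫ ω, (c * X ω).re ∂P = 0 := by
      have := integral_re (hXI.const_mul c)
      simp only [RCLike.re_eq_complex_re] at this
      rw [this, integral_const_mul, h0]; simp
    refine key (fun ω => (c * X ω).re + (1 + s ^ 2 * (Real.exp (‖X ω‖ ^ 2 / L ^ 2) - 1)))
      (hcX.add (hlinI _ _)) (fun ω => ?_) ?_
    · refine (exp_le_id_add_exp_sq _).trans ?_
      gcongr
      exact (Real.exp_le_exp.2 (hre' ω)).trans (exp_mul_le_one_add (sq_nonneg s) hs2 _)
    · rw [integral_add hcX (hlinI _ _), hcX0]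
      have := Real.add_one_le_exp (s ^ 2)
      linarith [hlin 1 (s ^ 2) (sq_nonneg s)]
  · refine key (fun ω => Real.exp (s ^ 2 / 2) *
      (1 + 1 / 2 * (Real.exp (‖X ω‖ ^ 2 / L ^ 2) - 1)))
      ((hlinI _ _).const_mul _)
      (fun ω => ?_) ?_
    · refine le_trans ?_ (mul_le_mul_of_nonneg_left
        (exp_mul_le_one_add (by norm_num) (by norm_num) _) (Real.exp_pos _).le)
      rw [← Real.exp_add, Real.exp_le_exp]
      refine (hre ω).trans ?_
      have : ‖c‖ * ‖X ω‖ = s * (‖X ω‖ / L) := by rw [hs]; field_simp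
      rw [this, ← div_pow]
      nlinarith [sq_nonneg (s - ‖X ω‖ / L)]
    · rw [integral_const_mul]
      have e1 : Real.exp (s ^ 2) = Real.exp (s ^ 2 / 2) * Real.exp (s ^ 2 / 2) := by
        rw [← Real.exp_add]; ring_nf
      rw [e1]
      have := Real.add_one_le_exp (s ^ 2 / 2)
      gcongr
      nlinarith [hlin 1 (1 / 2) (by norm_num)]

theorem lintegral_exp_re_sum_le {ι : Type*} [Fintype ι] {Z : ι → Ω → ℂ}
    (hZ : ∀ j, Measurable (Z j)) (hind : iIndepFun Z P) (h0 : ∀ j, ∫ ω, Z j ω ∂P = 0) {L : ℝ}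
    (hL : 0 < L) (hexp : ∀ j, ∫⁻ ω, ENNReal.ofReal (Real.exp (‖Z j ω‖ ^ 2 / L ^ 2)) ∂P ≤ 2)
    (c : ι → ℂ) :
    ∫⁻ ω, ENNReal.ofReal (Real.exp (∑ j, c j * Z j ω).re) ∂P
      ≤ ENNReal.ofReal (Real.exp ((∑ j, ‖c j‖ ^ 2) * L ^ 2)) := by
  have hm : ∀ j, Measurable fun z : ℂ => ENNReal.ofReal (Real.exp (c j * z).re) := by
    intro j; fun_prop
  calc _ = ∫⁻ ω, ∏ j, ENNReal.ofReal (Real.exp (c j * Z j ω).re) ∂P := by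
        refine lintegral_congr fun ω => ?_
        rw [Complex.re_sum, Real.exp_sum, ENNReal.ofReal_prod_of_nonneg]
        exact fun _ _ => (Real.exp_pos _).le
    _ = ∏ j, ∫⁻ ω, ENNReal.ofReal (Real.exp (c j * Z j ω).re) ∂P :=
        lintegral_prod_eq_prod_lintegral_of_indepFun Finset.univ _ (hind.comp _ hm)
          fun j => (hm j).comp (hZ j)
    _ ≤ ∏ j, ENNReal.ofReal (Real.exp (‖c j‖ ^ 2 * L ^ 2)) :=
        Finset.prod_le_prod' fun j _ => lintegral_exp_re_mul_le (hZ j) (h0 j) hL (hexp j) (c j)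
    _ = _ := by
        rw [Finset.sum_mul, Real.exp_sum, ENNReal.ofReal_prod_of_nonneg]
        exact fun _ _ => (Real.exp_pos _).le

theorem lintegral_exp_sq_gaussianReal_le :
    ∫⁻ τ, ENNReal.ofReal (Real.exp (τ ^ 2)) ∂(gaussianReal 0 (1 / 8)) ≤ 2 := by
  rw [gaussianReal_of_var_ne_zero _ (by norm_num),
    lintegral_withDensity_eq_lintegral_mul _ (measurable_gaussianPDF _ _) (by fun_prop)]
  -- The density of variance `1 / 8` times `exp (τ ^ 2)` is a multiple of that of variance `1 / 6`.
  calc _ ≤ ∫⁻ τ, 2 * gaussianPDF 0 (1 / 6) τ := by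
        refine lintegral_mono fun τ => ?_
        simp only [Pi.mul_apply, gaussianPDF_def]
        rw [← ENNReal.ofReal_mul (gaussianPDFReal_nonneg _ _ _), show (2 : ℝ≥0∞) =
          ENNReal.ofReal 2 by simp, ← ENNReal.ofReal_mul (by norm_num)]
        refine ENNReal.ofReal_le_ofReal ?_
        simp only [gaussianPDFReal_def, sub_zero]
        have e1 : Real.sqrt (2 * Real.pi * ((1 / 6 : NNReal) : ℝ)) ≤
            2 * Real.sqrt (2 * Real.pi * ((1 / 8 : NNReal) : ℝ)) := by
          rw [show (2 : ℝ) * Real.sqrt (2 * Real.pi * ((1 / 8 : NNReal) : ℝ)) =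
            Real.sqrt (2 ^ 2 * (2 * Real.pi * ((1 / 8 : NNReal) : ℝ))) by
              rw [Real.sqrt_mul (x := 2 ^ 2) (by norm_num), Real.sqrt_sq (by norm_num)]]
          refine Real.sqrt_le_sqrt ?_
          push_cast
          nlinarith [Real.pi_pos]
        have p1 : 0 < Real.sqrt (2 * Real.pi * ((1 / 6 : NNReal) : ℝ)) := by
          refine Real.sqrt_pos.2 ?_; push_cast; positivity
        have p2 : 0 < Real.sqrt (2 * Real.pi * ((1 / 8 : NNReal) : ℝ)) := by
          refine Real.sqrt_pos.2 ?_; push_cast; positivity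
        rw [mul_assoc, ← Real.exp_add, ← mul_assoc 2]
        have e2 : -τ ^ 2 / (2 * ((1 / 8 : NNReal) : ℝ)) + τ ^ 2 =
            -τ ^ 2 / (2 * ((1 / 6 : NNReal) : ℝ)) := by push_cast; ring
        rw [e2]
        gcongr
        rw [inv_eq_one_div, div_le_iff₀ p2]
        rw [mul_assoc, mul_comm (Real.sqrt _)⁻¹, ← mul_assoc, ← div_eq_mul_inv,
          le_div_iff₀ p1]
        linarith
    _ = 2 := by
        rw [lintegral_const_mul _ (measurable_gaussianPDF _ _),
          lintegral_gaussianPDF_eq_one _ (by norm_num), mul_one]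

/-- A real variable with subgaussian moment generating function has a square exponential moment:
average the moment generating function over a Gaussian argument. -/
theorem lintegral_exp_sq_le_of_mgf {S : Ω → ℝ} (hS : Measurable S) {L : ℝ} (hL : 0 < L)
    (h : ∀ τ : ℝ, ∫⁻ ω, ENNReal.ofReal (Real.exp (τ * S ω)) ∂P
      ≤ ENNReal.ofReal (Real.exp (τ ^ 2 * L ^ 2))) :
    ∫⁻ ω, ENNReal.ofReal (Real.exp (S ω ^ 2 / (16 * L ^ 2))) ∂P ≤ 2 := by
  calc _ = ∫⁻ ω, ∫⁻ τ, ENNReal.ofReal (Real.exp (τ / L * S ω)) ∂(gaussianReal 0 (1 / 8)) ∂P := by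
        refine lintegral_congr fun ω => ?_
        have e : ∀ τ : ℝ, τ / L * S ω = (S ω / L) * τ := fun τ => by ring
        simp only [e]
        rw [← ofReal_integral_eq_lintegral_ofReal (integrable_exp_mul_gaussianReal _)
          (ae_of_all _ fun _ => (Real.exp_pos _).le)]
        have := congrFun (mgf_fun_id_gaussianReal (μ := 0) (v := 1 / 8)) (S ω / L)
        rw [mgf] at this
        rw [this]
        congr 2
        push_cast
        field_simp
        ring
    _ = ∫⁻ τ, ∫⁻ ω, ENNReal.ofReal (Real.exp (τ / L * S ω)) ∂P ∂(gaussianReal 0 (1 / 8)) :=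
        lintegral_lintegral_swap (by fun_prop)
    _ ≤ ∫⁻ τ, ENNReal.ofReal (Real.exp (τ ^ 2)) ∂(gaussianReal 0 (1 / 8)) := by
        refine lintegral_mono fun τ => (h (τ / L)).trans_eq ?_
        congr 2
        field_simp
    _ ≤ 2 := lintegral_exp_sq_gaussianReal_le

theorem lintegral_exp_norm_sq_inner_le {n : ℕ} {ζ : Ω → EuclideanSpace ℂ (Fin n)}
    (hζ : Measurable ζ) (hind : iIndepFun (fun (j : Fin n) (ω : Ω) => ζ ω j) P)
    (h0 : ∀ j, ∫ ω, ζ ω j ∂P = 0) {L : ℝ} (hL : 0 < L)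
    (hexp : ∀ j, ∫⁻ ω, ENNReal.ofReal (Real.exp (‖ζ ω j‖ ^ 2 / L ^ 2)) ∂P ≤ 2)
    {v : EuclideanSpace ℂ (Fin n)} (hv : ‖v‖ = 1) :
    ∫⁻ ω, ENNReal.ofReal (Real.exp (‖inner ℂ v (ζ ω)‖ ^ 2 / (32 * L ^ 2))) ∂P ≤ 2 := by
  have hcoord : ∀ j, Measurable fun ω => ζ ω j := fun j => by fun_prop
  have hin : ∀ ω, inner ℂ v (ζ ω) = ∑ j, (starRingEnd ℂ) (v j) * ζ ω j := fun ω => by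
    rw [PiLp.inner_apply]
    exact Finset.sum_congr rfl fun j _ => by simp [mul_comm]
  have hm : Measurable fun ω => inner ℂ v (ζ ω) := by fun_prop
  have hnorm : ∑ j, ‖v j‖ ^ 2 = 1 := by rw [← EuclideanSpace.norm_sq_eq, hv, one_pow]
  have main : ∀ u : ℂ, ‖u‖ = 1 → ∫⁻ ω, ENNReal.ofReal
      (Real.exp ((u * inner ℂ v (ζ ω)).re ^ 2 / (16 * L ^ 2))) ∂P ≤ 2 := by
    intro u hu
    refine lintegral_exp_sq_le_of_mgf (by fun_prop) hL fun τ => ?_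
    have := lintegral_exp_re_sum_le hcoord hind h0 hL hexp
      (fun j => τ * u * (starRingEnd ℂ) (v j))
    have e1 : ∀ ω, (∑ j, (τ * u * (starRingEnd ℂ) (v j)) * ζ ω j).re =
        τ * (u * inner ℂ v (ζ ω)).re := fun ω => by
      rw [hin, ← Complex.re_ofReal_mul, ← mul_assoc, Finset.mul_sum]
      simp only [mul_assoc]
    have e2 : ∑ j, ‖τ * u * (starRingEnd ℂ) (v j)‖ ^ 2 = τ ^ 2 := by
      simp only [norm_mul, hu, RCLike.norm_conj, mul_one, mul_pow, ← Finset.mul_sum, hnorm]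
      simp
    simpa only [e1, e2] using this
  have h1 := main 1 (by simp)
  have h2 := main (-Complex.I) (by simp)
  have hsplit : ∀ ω, ENNReal.ofReal (Real.exp (‖inner ℂ v (ζ ω)‖ ^ 2 / (32 * L ^ 2))) ≤
      2⁻¹ * (ENNReal.ofReal (Real.exp ((1 * inner ℂ v (ζ ω)).re ^ 2 / (16 * L ^ 2))) +
        ENNReal.ofReal (Real.exp ((-Complex.I * inner ℂ v (ζ ω)).re ^ 2 / (16 * L ^ 2)))) := by
    intro ω
    generalize inner ℂ v (ζ ω) = z
    have e : ‖z‖ ^ 2 / (32 * L ^ 2) = 1 / 2 * ((1 * z).re ^ 2 / (16 * L ^ 2)) +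
        1 / 2 * ((-Complex.I * z).re ^ 2 / (16 * L ^ 2)) := by
      rw [← Complex.normSq_eq_norm_sq, Complex.normSq_apply]
      simp
      field_simp
      ring
    have hc := convexOn_exp.2 (Set.mem_univ ((1 * z).re ^ 2 / (16 * L ^ 2)))
      (Set.mem_univ ((-Complex.I * z).re ^ 2 / (16 * L ^ 2)))
      (by norm_num : (0 : ℝ) ≤ 1 / 2) (by norm_num : (0 : ℝ) ≤ 1 / 2) (by norm_num)
    simp only [smul_eq_mul] at hc
    rw [e, ← ENNReal.ofReal_add (Real.exp_pos _).le (Real.exp_pos _).le,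
      show (2 : ℝ≥0∞)⁻¹ = ENNReal.ofReal (1 / 2) by
        rw [one_div, ENNReal.ofReal_inv_of_pos (by norm_num)]; simp,
      ← ENNReal.ofReal_mul (by norm_num)]
    exact ENNReal.ofReal_le_ofReal (by linarith)
  calc _ ≤ ∫⁻ ω, 2⁻¹ * (ENNReal.ofReal (Real.exp ((1 * inner ℂ v (ζ ω)).re ^ 2 / (16 * L ^ 2))) +
        ENNReal.ofReal (Real.exp ((-Complex.I * inner ℂ v (ζ ω)).re ^ 2 / (16 * L ^ 2)))) ∂P :=
        lintegral_mono hsplit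
    _ ≤ 2⁻¹ * (2 + 2) := by
        rw [lintegral_const_mul _ (by fun_prop), lintegral_add_left (by fun_prop)]
        gcongr
    _ = 2 := by
        rw [← two_mul, ← mul_assoc, ENNReal.inv_mul_cancel (by simp) (by simp), one_mul]

end Subgaussian

/-! ### Symmetrization and contraction for exponential moments -/

/-- The law of a uniformly distributed sign. -/
noncomputable def rademacher : Measure ℝ :=
  (2⁻¹ : ℝ≥0∞) • (Measure.dirac 1 + Measure.dirac (-1))

instance : IsProbabilityMeasure rademacher := by
  refine ⟨?_⟩
  simp only [rademacher, Measure.smul_apply, Measure.add_apply, measure_univ, smul_eq_mul,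
    one_add_one_eq_two]
  exact ENNReal.inv_mul_cancel (by simp) (by simp)

theorem lintegral_rademacher (f : ℝ → ℝ≥0∞) :
    ∫⁻ ε, f ε ∂rademacher = 2⁻¹ * (f 1 + f (-1)) := by
  simp [rademacher, lintegral_add_measure, mul_add]

theorem lintegral_pi_succ {A : Type*} [MeasurableSpace A] (μ : Measure A) [SigmaFinite μ] {m : ℕ}
    {f : (Fin (m + 1) → A) → ℝ≥0∞} (hf : Measurable f) :
    ∫⁻ x, f x ∂Measure.pi (fun _ : Fin (m + 1) => μ)
      = ∫⁻ a, ∫⁻ y, f (Fin.cons a y) ∂Measure.pi (fun _ : Fin m => μ) ∂μ := by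
  have h := (measurePreserving_piFinSuccAbove (fun _ : Fin (m + 1) => μ) 0).symm
  rw [← h.lintegral_comp hf, lintegral_prod]
  · simp only [MeasurableEquiv.piFinSuccAbove_symm_apply, Fin.insertNthEquiv_zero]
    rfl
  · exact (hf.comp h.measurable).aemeasurable

/-- A comparison of exponential moments of suprema which is uniform in a shift `u` carries over
from one summand to sums of independent copies. -/
theorem lintegral_iSup_exp_sum_le {ι A B : Type*} [Countable ι] [MeasurableSpace A]
    [MeasurableSpace B] {μ : Measure A} {ν : Measure B} [IsProbabilityMeasure μ]
    [IsProbabilityMeasure ν] {F : ι → A → ℝ} {G : ι → B → ℝ} (hF : ∀ t, Measurable (F t))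
    (hG : ∀ t, Measurable (G t))
    (h : ∀ u : ι → ℝ, ∫⁻ a, ⨆ t, ENNReal.ofReal (Real.exp (u t + F t a)) ∂μ
      ≤ ∫⁻ b, ⨆ t, ENNReal.ofReal (Real.exp (u t + G t b)) ∂ν) (m : ℕ) (u : ι → ℝ) :
    ∫⁻ a, ⨆ t, ENNReal.ofReal (Real.exp (u t + ∑ i, F t (a i))) ∂Measure.pi (fun _ : Fin m => μ)
      ≤ ∫⁻ b, ⨆ t, ENNReal.ofReal (Real.exp (u t + ∑ i, G t (b i)))
        ∂Measure.pi (fun _ : Fin m => ν) := by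
  induction m generalizing u with
  | zero => simp
  | succ m ih =>
    rw [lintegral_pi_succ μ (by fun_prop), lintegral_pi_succ ν (by fun_prop)]
    simp only [Fin.sum_univ_succ, Fin.cons_zero, Fin.cons_succ, ← add_assoc]
    calc _ ≤ ∫⁻ a, ∫⁻ y, ⨆ t, ENNReal.ofReal (Real.exp (u t + F t a + ∑ i, G t (y i)))
          ∂Measure.pi (fun _ : Fin m => ν) ∂μ :=
          lintegral_mono fun a => ih fun t => u t + F t a
      _ = ∫⁻ y, ∫⁻ a, ⨆ t, ENNReal.ofReal (Real.exp (u t + F t a + ∑ i, G t (y i)))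
          ∂μ ∂Measure.pi (fun _ : Fin m => ν) := lintegral_lintegral_swap (by fun_prop)
      _ ≤ ∫⁻ y, ∫⁻ b, ⨆ t, ENNReal.ofReal (Real.exp (u t + G t b + ∑ i, G t (y i)))
          ∂ν ∂Measure.pi (fun _ : Fin m => ν) := by
          refine lintegral_mono fun y => ?_
          simpa only [add_right_comm] using h fun t => u t + ∑ i, G t (y i)
      _ = _ := lintegral_lintegral_swap (by fun_prop)

theorem ofReal_exp_integral_le {A : Type*} [MeasurableSpace A] {μ : Measure A}
    [IsProbabilityMeasure μ] {f : A → ℝ} (hf : Integrable f μ) :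
    ENNReal.ofReal (Real.exp (∫ a, f a ∂μ)) ≤ ∫⁻ a, ENNReal.ofReal (Real.exp (f a)) ∂μ := by
  by_cases htop : ∫⁻ a, ENNReal.ofReal (Real.exp (f a)) ∂μ = ⊤
  · rw [htop]; exact le_top
  have hI : Integrable (fun a => Real.exp (f a)) μ := by
    refine ⟨Real.continuous_exp.comp_aestronglyMeasurable hf.aestronglyMeasurable, ?_⟩
    rw [hasFiniteIntegral_iff_ofReal (ae_of_all _ fun _ => (Real.exp_pos _).le)]
    exact lt_top_iff_ne_top.2 htop
  rw [← ofReal_integral_eq_lintegral_ofReal hI (ae_of_all _ fun _ => (Real.exp_pos _).le)]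
  exact ENNReal.ofReal_le_ofReal (convexOn_exp.map_integral_le Real.continuous_exp.continuousOn
    isClosed_univ (ae_of_all _ fun _ => Set.mem_univ _) hf hI)

/-- The contraction principle for the absolute value and a single sign. -/
theorem iSup_exp_add_abs_add_iSup_exp_sub_abs_le {ι : Type*} [Nonempty ι] (u s : ι → ℝ) :
    (⨆ t, ENNReal.ofReal (Real.exp (u t + |s t|))) + (⨆ t, ENNReal.ofReal (Real.exp (u t - |s t|)))
      ≤ (⨆ t, ENNReal.ofReal (Real.exp (u t + s t)))
        + ⨆ t, ENNReal.ofReal (Real.exp (u t - s t)) := by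
  have mono : ∀ {x y : ℝ}, x ≤ y → ENNReal.ofReal (Real.exp x) ≤ ENNReal.ofReal (Real.exp y) :=
    fun h => ENNReal.ofReal_le_ofReal (Real.exp_le_exp.2 h)
  have hp : ∀ t {x : ℝ}, x ≤ u t + s t →
      ENNReal.ofReal (Real.exp x) ≤ ⨆ t, ENNReal.ofReal (Real.exp (u t + s t)) :=
    fun t x h => (mono h).trans (le_iSup (fun t => ENNReal.ofReal (Real.exp (u t + s t))) t)
  have hn : ∀ t {x : ℝ}, x ≤ u t - s t →
      ENNReal.ofReal (Real.exp x) ≤ ⨆ t, ENNReal.ofReal (Real.exp (u t - s t)) :=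
    fun t x h => (mono h).trans (le_iSup (fun t => ENNReal.ofReal (Real.exp (u t - s t))) t)
  refine ENNReal.iSup_add_iSup_le fun t t' => ?_
  -- Only the sign of `s t` matters: `-|s t'|` lies below both `s t'` and `-s t'`.
  rcases le_total 0 (s t) with h | h
  · refine add_le_add (hp t ?_) (hn t' ?_)
    · rw [abs_of_nonneg h]
    · linarith [le_abs_self (s t')]
  · rw [add_comm]
    refine add_le_add (hp t' ?_) (hn t ?_)
    · linarith [neg_abs_le (s t')]
    · rw [abs_of_nonpos h]; linarith

/-- Symmetrization followed by contraction, for a single summand. -/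
theorem lintegral_iSup_exp_integral_abs_sub_le {ι A : Type*} [Countable ι] [Nonempty ι]
    [MeasurableSpace A] {μ : Measure A} [IsProbabilityMeasure μ] {Y : ι → A → ℝ}
    (hY : ∀ t, Measurable (Y t)) (hI : ∀ t, Integrable (Y t) μ) (u : ι → ℝ) :
    ∫⁻ a, ⨆ t, ENNReal.ofReal (Real.exp (u t + (∫ x, |Y t x| ∂μ - |Y t a|))) ∂μ
      ≤ ∫⁻ p, ⨆ t, ENNReal.ofReal (Real.exp (u t + 2 * (p.2 * Y t p.1))) ∂(μ.prod rademacher) := by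
  have hYa : ∀ t, Measurable fun a => |Y t a| := fun t => (hY t).norm
  have hPm : Measurable fun a => ⨆ t, ENNReal.ofReal (Real.exp (u t + |2 * Y t a|)) :=
    Measurable.iSup fun t => by
      simp only [abs_mul]; fun_prop
  have hNm : Measurable fun a => ⨆ t, ENNReal.ofReal (Real.exp (u t - |2 * Y t a|)) :=
    Measurable.iSup fun t => by
      simp only [abs_mul]; fun_prop
  have hadd : ∀ {f g : A → ℝ≥0∞}, Measurable f →
      ∫⁻ a, 2⁻¹ * (f a + g a) ∂μ = 2⁻¹ * ((∫⁻ a, f a ∂μ) + ∫⁻ a, g a ∂μ) := fun {f g} hf => by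
    rw [lintegral_const_mul' _ _ (by simp), lintegral_add_left hf]
  have step : ∀ a, ⨆ t, ENNReal.ofReal (Real.exp (u t + (∫ x, |Y t x| ∂μ - |Y t a|))) ≤
      ∫⁻ x, 2⁻¹ * ((⨆ t, ENNReal.ofReal (Real.exp (u t + |2 * Y t x|))) +
        ⨆ t, ENNReal.ofReal (Real.exp (u t - |2 * Y t a|))) ∂μ := by
    intro a
    refine iSup_le fun t => ?_
    have hIt : Integrable (fun x => (u t - |Y t a|) + |Y t x|) μ :=
      (integrable_const _).add (hI t).abs
    have e : u t + (∫ x, |Y t x| ∂μ - |Y t a|) = ∫ x, ((u t - |Y t a|) + |Y t x|) ∂μ := by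
      rw [integral_add (integrable_const _) (hI t).abs]
      simp only [integral_const, probReal_univ, smul_eq_mul, one_mul]
      ring
    rw [e]
    refine (ofReal_exp_integral_le hIt).trans (lintegral_mono fun x => ?_)
    refine le_trans ?_ (mul_le_mul_right (add_le_add
      (le_iSup (fun t => ENNReal.ofReal (Real.exp (u t + |2 * Y t x|))) t)
      (le_iSup (fun t => ENNReal.ofReal (Real.exp (u t - |2 * Y t a|))) t)) _)
    have hc := convexOn_exp.2 (Set.mem_univ (u t + |2 * Y t x|)) (Set.mem_univ (u t - |2 * Y t a|))
      (by norm_num : (0 : ℝ) ≤ 1 / 2) (by norm_num : (0 : ℝ) ≤ 1 / 2) (by norm_num)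
    simp only [smul_eq_mul] at hc
    rw [← ENNReal.ofReal_add (Real.exp_pos _).le (Real.exp_pos _).le,
      show (2 : ℝ≥0∞)⁻¹ = ENNReal.ofReal (1 / 2) by
        rw [one_div, ENNReal.ofReal_inv_of_pos (by norm_num)]; simp,
      ← ENNReal.ofReal_mul (by norm_num)]
    refine ENNReal.ofReal_le_ofReal (le_trans (Real.exp_le_exp.2 (le_of_eq ?_)) (hc.trans_eq ?_))
    · rw [abs_mul, abs_mul, abs_two]; ring
    · ring
  calc _ ≤ ∫⁻ a, ∫⁻ x, 2⁻¹ * ((⨆ t, ENNReal.ofReal (Real.exp (u t + |2 * Y t x|))) +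
        ⨆ t, ENNReal.ofReal (Real.exp (u t - |2 * Y t a|))) ∂μ ∂μ := lintegral_mono step
    _ = ∫⁻ a, 2⁻¹ * ((⨆ t, ENNReal.ofReal (Real.exp (u t + |2 * Y t a|))) +
        ⨆ t, ENNReal.ofReal (Real.exp (u t - |2 * Y t a|))) ∂μ := by
        simp only [hadd hPm, hadd measurable_const]
        simp
    _ ≤ ∫⁻ a, 2⁻¹ * ((⨆ t, ENNReal.ofReal (Real.exp (u t + 2 * Y t a))) +
        ⨆ t, ENNReal.ofReal (Real.exp (u t - 2 * Y t a))) ∂μ :=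
        lintegral_mono fun a => mul_le_mul_right
          (iSup_exp_add_abs_add_iSup_exp_sub_abs_le u fun t => 2 * Y t a) _
    _ = _ := by
        rw [lintegral_prod _ (by fun_prop)]
        refine lintegral_congr fun a => ?_
        rw [lintegral_rademacher]
        simp [sub_eq_add_neg]

/-! ### A net of the complex unit sphere -/

theorem exists_net_unit_sphere (n : ℕ) :
    ∃ s : Finset (EuclideanSpace ℂ (Fin n)), (∀ w ∈ s, ‖w‖ = 1) ∧
      (∀ v : EuclideanSpace ℂ (Fin n), ‖v‖ = 1 → ∃ w ∈ s, ‖v - w‖ ≤ 1 / 2) ∧ s.card ≤ 25 ^ n := by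
  classical
  let p : Finset (EuclideanSpace ℂ (Fin n)) → Prop := fun s =>
    (∀ w ∈ s, ‖w‖ = 1) ∧ ∀ v ∈ s, ∀ w ∈ s, v ≠ w → 1 / 2 ≤ ‖v - w‖
  have hcard : ∀ s, p s → s.card ≤ 25 ^ n := by
    intro s hs
    have hinj : Function.Injective fun w : EuclideanSpace ℂ (Fin n) => (2 : ℝ) • w :=
      smul_right_injective _ two_ne_zero
    have h := Besicovitch.card_le_of_separated (s.image fun w => (2 : ℝ) • w)
      (by
        simp only [Finset.mem_image]
        rintro _ ⟨w, hw, rfl⟩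
        rw [norm_smul, hs.1 w hw]; norm_num)
      (by
        simp only [Finset.mem_image]
        rintro _ ⟨v, hv, rfl⟩ _ ⟨w, hw, rfl⟩ hne
        have := hs.2 v hv w hw fun h => hne (by rw [h])
        rw [← smul_sub, norm_smul, Real.norm_two]
        linarith)
    rw [Finset.card_image_of_injective _ hinj, finrank_real_of_complex,
      finrank_euclideanSpace_fin, pow_mul] at h
    simpa using h
  have hmem := Nat.sSup_mem (s := {k | ∃ s, p s ∧ s.card = k}) ⟨0, ∅, by simp [p], rfl⟩
    ⟨25 ^ n, by rintro _ ⟨s, hs, rfl⟩; exact hcard s hs⟩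
  obtain ⟨s, hs, hsc⟩ := hmem
  refine ⟨s, hs.1, fun v hv => ?_, hcard s hs⟩
  by_contra! hfar
  have hvs : v ∉ s := fun h => by have := hfar v h; simp at this; linarith
  have hp : p (insert v s) := by
    refine ⟨fun w hw => ?_, fun a ha b hb hab => ?_⟩
    · rcases Finset.mem_insert.1 hw with rfl | hw
      exacts [hv, hs.1 w hw]
    · rcases Finset.mem_insert.1 ha with rfl | ha' <;> rcases Finset.mem_insert.1 hb with rfl | hb'
      · exact absurd rfl hab
      · exact (hfar b hb').le
      · rw [norm_sub_rev]; exact (hfar a ha').le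
      · exact hs.2 a ha' b hb' hab
  have hle := le_csSup (s := {k | ∃ s, p s ∧ s.card = k})
    ⟨25 ^ n, by rintro _ ⟨s, hs, rfl⟩; exact hcard s hs⟩ ⟨insert v s, hp, rfl⟩
  rw [← hsc, Finset.card_insert_of_notMem hvs] at hle
  omega

/-- The Hermitian form `∑ i, ε i * ‖⟪x i, v⟫‖ ^ 2` in the variable `v`. -/
noncomputable def signedForm {n m : ℕ} (x : Fin m → EuclideanSpace ℂ (Fin n)) (ε : Fin m → ℝ)
    (v : EuclideanSpace ℂ (Fin n)) : ℝ :=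
  ∑ i, ε i * ‖inner ℂ (x i) v‖ ^ 2

theorem signedForm_smul {n m : ℕ} (x : Fin m → EuclideanSpace ℂ (Fin n)) (ε : Fin m → ℝ) (a : ℝ)
    (v : EuclideanSpace ℂ (Fin n)) : signedForm x ε (a • v) = a ^ 2 * signedForm x ε v := by
  simp only [signedForm, Finset.mul_sum]
  refine Finset.sum_congr rfl fun i _ => ?_
  rw [← Complex.coe_smul, inner_smul_right, norm_mul, mul_pow, Complex.norm_real,
    Real.norm_eq_abs, sq_abs]
  ring

theorem four_mul_signedForm_sub {n m : ℕ} (x : Fin m → EuclideanSpace ℂ (Fin n)) (ε : Fin m → ℝ)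
    (v w : EuclideanSpace ℂ (Fin n)) :
    4 * (4 * (signedForm x ε v - signedForm x ε w)) =
      signedForm x ε ((5 : ℝ) • v - (3 : ℝ) • w) - signedForm x ε ((3 : ℝ) • v - (5 : ℝ) • w) := by
  simp only [signedForm, Finset.mul_sum, ← Finset.sum_sub_distrib]
  refine Finset.sum_congr rfl fun i _ => ?_
  rw [inner_sub_right, inner_sub_right]
  simp only [← Complex.coe_smul, inner_smul_right, ← Complex.normSq_eq_norm_sq,
    Complex.normSq_apply]
  simp
  ring

/-- A Hermitian form that is small on a `1 / 2`-net of the unit sphere is small on the unit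
sphere. -/
theorem abs_signedForm_le_of_net {n m : ℕ} {s : Finset (EuclideanSpace ℂ (Fin n))}
    (hs1 : ∀ w ∈ s, ‖w‖ = 1)
    (hs : ∀ v : EuclideanSpace ℂ (Fin n), ‖v‖ = 1 → ∃ w ∈ s, ‖v - w‖ ≤ 1 / 2)
    (x : Fin m → EuclideanSpace ℂ (Fin n)) (ε : Fin m → ℝ) {b : ℝ}
    (hb : ∀ w ∈ s, |signedForm x ε w| ≤ b) {v : EuclideanSpace ℂ (Fin n)} (hv : ‖v‖ = 1) :
    |signedForm x ε v| ≤ 32 * b := by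
  have hcont : Continuous fun v => |signedForm x ε v| := by
    unfold signedForm; fun_prop
  obtain ⟨v₀, hv₀, hmax⟩ := (isCompact_sphere (0 : EuclideanSpace ℂ (Fin n)) 1).exists_isMaxOn
    ⟨v, by simpa using hv⟩ hcont.continuousOn
  have hv₀' : ‖v₀‖ = 1 := by simpa using hv₀
  set ρ := |signedForm x ε v₀| with hρ
  have hle : ∀ y, ‖y‖ = 1 → |signedForm x ε y| ≤ ρ := fun y hy => hmax (by simpa using hy)
  have hhom : ∀ y, |signedForm x ε y| ≤ ρ * ‖y‖ ^ 2 := by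
    intro y
    rcases eq_or_ne y 0 with rfl | hy
    · simp [signedForm]
    · have hy' : ‖y‖ ≠ 0 := norm_ne_zero_iff.2 hy
      have e : y = ‖y‖ • (‖y‖⁻¹ • y) := by rw [smul_smul, mul_inv_cancel₀ hy', one_smul]
      have hu : ‖‖y‖⁻¹ • y‖ = 1 := by
        rw [norm_smul, norm_inv, norm_norm, inv_mul_cancel₀ hy']
      have := hle _ hu
      rw [e, signedForm_smul, abs_mul, abs_of_nonneg (sq_nonneg _), ← e]
      nlinarith [sq_nonneg ‖y‖]
  obtain ⟨w, hw, hd⟩ := hs v₀ hv₀'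
  -- With the weights `5` and `3` the squared norms sum up to less than the factor `16` in
  -- `four_mul_signedForm_sub`, so that the comparison of `v₀` with `w` below gains.
  have hnorm : ‖(5 : ℝ) • v₀ - (3 : ℝ) • w‖ ^ 2 + ‖(3 : ℝ) • v₀ - (5 : ℝ) • w‖ ^ 2 ≤ 31 / 2 := by
    have hw1 := hs1 w hw
    have e0 := norm_sub_sq_real v₀ w
    have e1 := norm_sub_sq_real ((5 : ℝ) • v₀) ((3 : ℝ) • w)
    have e2 := norm_sub_sq_real ((3 : ℝ) • v₀) ((5 : ℝ) • w)
    simp only [real_inner_smul_left, real_inner_smul_right, norm_smul, hv₀', hw1] at e0 e1 e2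
    have hd2 : ‖v₀ - w‖ ^ 2 ≤ (1 / 2) ^ 2 := by gcongr
    norm_num at e0 e1 e2 hd2 ⊢
    linarith
  have hdiff := four_mul_signedForm_sub x ε v₀ w
  have h1 := hhom ((5 : ℝ) • v₀ - (3 : ℝ) • w)
  have h2 := hhom ((3 : ℝ) • v₀ - (5 : ℝ) • w)
  have hρ0 : 0 ≤ ρ := abs_nonneg _
  have h3 : 16 * |signedForm x ε v₀ - signedForm x ε w| ≤ ρ * (31 / 2) := by
    have : 16 * |signedForm x ε v₀ - signedForm x ε w| =
        |signedForm x ε ((5 : ℝ) • v₀ - (3 : ℝ) • w)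
          - signedForm x ε ((3 : ℝ) • v₀ - (5 : ℝ) • w)| := by
      rw [← hdiff, abs_mul, abs_mul, abs_of_nonneg (by norm_num : (0 : ℝ) ≤ 4)]; ring
    rw [this]
    refine (abs_sub _ _).trans ((add_le_add h1 h2).trans ?_)
    rw [← mul_add]
    gcongr
  have h4 := abs_sub_abs_le_abs_sub (signedForm x ε v₀) (signedForm x ε w)
  have := hb w hw
  have := hle v hv
  linarith

/-! ### Hermitian forms of trace norm one -/

/-- The forms `x ↦ x* H x` of the Hermitian matrices `H` of trace norm one, written in terms of
the eigenvalues and eigenvectors of `H`. -/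
def unitForms (n : ℕ) : Set (EuclideanSpace ℂ (Fin n) → ℝ) :=
  {Y | ∃ (c : Fin n → ℝ) (v : Fin n → EuclideanSpace ℂ (Fin n)), (∀ k, ‖v k‖ = 1) ∧
    ∑ k, |c k| = 1 ∧ ∀ x, Y x = ∑ k, c k * ‖inner ℂ (v k) x‖ ^ 2}

theorem measurable_of_mem_unitForms {n : ℕ} {Y : EuclideanSpace ℂ (Fin n) → ℝ}
    (hY : Y ∈ unitForms n) : Measurable Y := by
  obtain ⟨c, v, -, -, h⟩ := hY
  rw [funext h]
  fun_prop

theorem exp_sum_mul_le_sum_net {n m : ℕ} {s : Finset (EuclideanSpace ℂ (Fin n))}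
    (hs1 : ∀ w ∈ s, ‖w‖ = 1)
    (hs : ∀ v : EuclideanSpace ℂ (Fin n), ‖v‖ = 1 → ∃ w ∈ s, ‖v - w‖ ≤ 1 / 2)
    (x : Fin m → EuclideanSpace ℂ (Fin n)) (ε : Fin m → ℝ) {a : ℝ} (ha : 0 ≤ a)
    {Y : EuclideanSpace ℂ (Fin n) → ℝ} (hY : Y ∈ unitForms n) :
    Real.exp (a * ∑ i, ε i * Y (x i)) ≤
      ∑ w ∈ s, (Real.exp (32 * a * signedForm x ε w) + Real.exp (-(32 * a) * signedForm x ε w)) := by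
  obtain ⟨c, v, hv, hc, hYx⟩ := hY
  have hne : s.Nonempty := by
    by_contra h
    rw [Finset.not_nonempty_iff_eq_empty] at h
    have : (Finset.univ : Finset (Fin n)).Nonempty := by
      by_contra h'
      rw [Finset.not_nonempty_iff_eq_empty] at h'
      simp [h'] at hc
    obtain ⟨k, -⟩ := this
    obtain ⟨w, hw, -⟩ := hs (v k) (hv k)
    simp [h] at hw
  obtain ⟨w, hw, hmax⟩ := s.exists_max_image (fun w => |signedForm x ε w|) hne
  have hle : ∑ i, ε i * Y (x i) ≤ 32 * |signedForm x ε w| := by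
    have e : ∑ i, ε i * Y (x i) = ∑ k, c k * signedForm x ε (v k) := by
      simp only [hYx, signedForm, Finset.mul_sum]
      rw [Finset.sum_comm]
      refine Finset.sum_congr rfl fun k _ => Finset.sum_congr rfl fun i _ => ?_
      rw [norm_inner_symm]; ring
    rw [e, ← one_mul (32 * _), ← hc, Finset.sum_mul]
    refine Finset.sum_le_sum fun k _ => (le_abs_self _).trans ?_
    rw [abs_mul]
    exact mul_le_mul_of_nonneg_left (abs_signedForm_le_of_net hs1 hs x ε hmax (hv k))
      (abs_nonneg _)
  have h1 : Real.exp (a * ∑ i, ε i * Y (x i)) ≤ Real.exp (32 * a * |signedForm x ε w|) := by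
    rw [Real.exp_le_exp]
    calc _ ≤ a * (32 * |signedForm x ε w|) := by gcongr
      _ = _ := by ring
  refine h1.trans (le_trans ?_ (Finset.single_le_sum (fun w _ => by positivity) hw))
  rcases abs_cases (signedForm x ε w) with ⟨h, -⟩ | ⟨h, -⟩ <;> rw [h]
  · linarith [Real.exp_pos (-(32 * a) * signedForm x ε w)]
  · rw [mul_neg, ← neg_mul]
    linarith [Real.exp_pos (32 * a * signedForm x ε w)]

section Moments

variable {n : ℕ} {μ : Measure (EuclideanSpace ℂ (Fin n))} {R : ℝ}

theorem integrable_and_integral_pow_six_le (hR : 0 < R)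
    (hexp : ∀ v : EuclideanSpace ℂ (Fin n), ‖v‖ = 1 →
      ∫⁻ x, ENNReal.ofReal (Real.exp (‖inner ℂ v x‖ ^ 2 / R)) ∂μ ≤ 2)
    {Y : EuclideanSpace ℂ (Fin n) → ℝ} (hY : Y ∈ unitForms n) :
    Integrable (fun x => Y x ^ 6) μ ∧ ∫ x, Y x ^ 6 ∂μ ≤ 1440 * R ^ 6 := by
  have hYm := measurable_of_mem_unitForms hY
  obtain ⟨c, v, hv, hc, hYx⟩ := hY
  have hm : ∀ k, Measurable fun x => Real.exp (‖inner ℂ (v k) x‖ ^ 2 / R) := fun k => by fun_prop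
  have hI : ∀ k, Integrable (fun x => Real.exp (‖inner ℂ (v k) x‖ ^ 2 / R)) μ := by
    intro k
    refine ⟨(hm k).aestronglyMeasurable, ?_⟩
    rw [hasFiniteIntegral_iff_ofReal (ae_of_all _ fun _ => (Real.exp_pos _).le)]
    exact (hexp _ (hv k)).trans_lt (by simp)
  have hI2 : ∀ k, ∫ x, Real.exp (‖inner ℂ (v k) x‖ ^ 2 / R) ∂μ ≤ 2 := by
    intro k
    rw [integral_eq_lintegral_of_nonneg_ae (ae_of_all _ fun _ => (Real.exp_pos _).le)
      (hm k).aestronglyMeasurable]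
    exact ENNReal.toReal_le_of_le_ofReal (by norm_num) (by simpa using hexp _ (hv k))
  have hdom : ∀ x, Y x ^ 6 ≤ ∑ k, |c k| * (720 * R ^ 6 * Real.exp (‖inner ℂ (v k) x‖ ^ 2 / R)) := by
    intro x
    have h1 : |Y x| ≤ ∑ k, |c k| * ‖inner ℂ (v k) x‖ ^ 2 := by
      rw [hYx]
      refine (Finset.abs_sum_le_sum_abs _ _).trans (Finset.sum_le_sum fun k _ => ?_)
      rw [abs_mul, abs_of_nonneg (sq_nonneg ‖inner ℂ (v k) x‖)]
    have h2 : Y x ^ 6 ≤ (∑ k, |c k| * ‖inner ℂ (v k) x‖ ^ 2) ^ 6 := by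
      rw [← Even.pow_abs (by decide : Even 6)]
      gcongr
    refine h2.trans ((Real.pow_arith_mean_le_arith_mean_pow Finset.univ (fun k => |c k|) _
      (fun k _ => abs_nonneg _) hc (fun k _ => sq_nonneg _) 6).trans ?_)
    refine Finset.sum_le_sum fun k _ => mul_le_mul_of_nonneg_left ?_ (abs_nonneg _)
    have h3 := Real.pow_div_factorial_le_exp (x := ‖inner ℂ (v k) x‖ ^ 2 / R) (by positivity) 6
    have h4 : (‖inner ℂ (v k) x‖ ^ 2) ^ 6 = 720 * R ^ 6 *
        ((‖inner ℂ (v k) x‖ ^ 2 / R) ^ 6 / (Nat.factorial 6 : ℝ)) := by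
      simp [Nat.factorial]; field_simp
    rw [h4]
    gcongr
  have hsumI : Integrable (fun x => ∑ k, |c k| *
      (720 * R ^ 6 * Real.exp (‖inner ℂ (v k) x‖ ^ 2 / R))) μ :=
    integrable_finsetSum _ fun k _ => ((hI k).const_mul _).const_mul _
  have h6 : Integrable (fun x => Y x ^ 6) μ := by
    refine hsumI.mono' (hYm.pow_const 6).aestronglyMeasurable (ae_of_all _ fun x => ?_)
    rw [Real.norm_eq_abs, abs_of_nonneg (Even.pow_nonneg (by decide) _)]
    exact hdom x
  refine ⟨h6, (integral_mono h6 hsumI hdom).trans ?_⟩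
  rw [integral_finsetSum _ fun k _ => ((hI k).const_mul _).const_mul _]
  calc _ ≤ ∑ k, |c k| * (1440 * R ^ 6) := by
        refine Finset.sum_le_sum fun k _ => ?_
        rw [integral_const_mul, integral_const_mul]
        refine mul_le_mul_of_nonneg_left ?_ (abs_nonneg _)
        nlinarith [hI2 k, pow_pos hR 6]
    _ = _ := by rw [← Finset.sum_mul, hc, one_mul]

variable [IsProbabilityMeasure μ]

/-- The factors are averages of `cosh (θ W / R) ≤ 1 + θ ^ 2 * exp (W / R)`, where
`W = ‖⟪w, x⟫‖ ^ 2`. -/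
theorem lintegral_exp_signed_le (hR : 0 < R) {w : EuclideanSpace ℂ (Fin n)}
    (hexp : ∫⁻ x, ENNReal.ofReal (Real.exp (‖inner ℂ w x‖ ^ 2 / R)) ∂μ ≤ 2) {θ : ℝ}
    (hθ : |θ| ≤ 1) (m : ℕ) :
    ∫⁻ p, ENNReal.ofReal (Real.exp (θ / R * signedForm (fun i => (p i).1) (fun i => (p i).2) w))
        ∂Measure.pi (fun _ : Fin m => μ.prod rademacher)
      ≤ ENNReal.ofReal (Real.exp (m * (2 * θ ^ 2))) := by
  have hone : ∀ u : Unit → ℝ, ∫⁻ p, ⨆ t, ENNReal.ofReal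
      (Real.exp (u t + θ / R * (p.2 * ‖inner ℂ p.1 w‖ ^ 2))) ∂(μ.prod rademacher)
      ≤ ∫⁻ _ : Unit, ⨆ t, ENNReal.ofReal (Real.exp (u t + 2 * θ ^ 2)) ∂Measure.dirac () := by
    intro u
    simp only [ciSup_unique, lintegral_const, measure_univ, mul_one]
    rw [lintegral_prod _ (by fun_prop)]
    simp only [lintegral_rademacher]
    have hpt : ∀ x : EuclideanSpace ℂ (Fin n),
        2⁻¹ * (ENNReal.ofReal (Real.exp (u default + θ / R * (1 * ‖inner ℂ x w‖ ^ 2))) +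
          ENNReal.ofReal (Real.exp (u default + θ / R * (-1 * ‖inner ℂ x w‖ ^ 2)))) ≤
        ENNReal.ofReal (Real.exp (u default)) * (1 + ENNReal.ofReal (θ ^ 2) *
          ENNReal.ofReal (Real.exp (‖inner ℂ w x‖ ^ 2 / R))) := by
      intro x
      rw [norm_inner_symm x w]
      have hc := cosh_mul_le_one_add (abs_nonneg θ) hθ
        (w := ‖inner ℂ w x‖ ^ 2 / R) (by positivity)
      have hc' : Real.cosh (|θ| * (‖inner ℂ w x‖ ^ 2 / R)) =
          Real.cosh (θ * (‖inner ℂ w x‖ ^ 2 / R)) := by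
        rw [← Real.cosh_abs (θ * _), abs_mul, abs_of_nonneg (a := ‖inner ℂ w x‖ ^ 2 / R)
          (by positivity)]
      rw [hc', sq_abs, Real.cosh_eq] at hc
      rw [← ENNReal.ofReal_mul (sq_nonneg _), ← ENNReal.ofReal_one,
        ← ENNReal.ofReal_add zero_le_one (by positivity), ← ENNReal.ofReal_mul (by positivity),
        ← ENNReal.ofReal_add (by positivity) (by positivity), show (2 : ℝ≥0∞)⁻¹ =
          ENNReal.ofReal (1 / 2) by rw [one_div, ENNReal.ofReal_inv_of_pos (by norm_num)]; simp,
        ← ENNReal.ofReal_mul (by norm_num)]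
      refine ENNReal.ofReal_le_ofReal ?_
      rw [Real.exp_add, Real.exp_add]
      calc _ = Real.exp (u default) * ((Real.exp (θ * (‖inner ℂ w x‖ ^ 2 / R)) +
            Real.exp (-(θ * (‖inner ℂ w x‖ ^ 2 / R)))) / 2) := by
            rw [show θ / R * (1 * ‖inner ℂ w x‖ ^ 2) = θ * (‖inner ℂ w x‖ ^ 2 / R) by ring,
              show θ / R * (-1 * ‖inner ℂ w x‖ ^ 2) = -(θ * (‖inner ℂ w x‖ ^ 2 / R)) by ring]
            ring
        _ ≤ _ := by gcongr
    refine (lintegral_mono hpt).trans ?_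
    rw [lintegral_const_mul' _ _ (by simp), lintegral_add_left (by fun_prop),
      lintegral_const_mul' _ _ (by simp)]
    simp only [lintegral_const, measure_univ, mul_one]
    calc _ ≤ ENNReal.ofReal (Real.exp (u default)) * (1 + ENNReal.ofReal (θ ^ 2) * 2) := by gcongr
      _ = ENNReal.ofReal (Real.exp (u default) * (1 + θ ^ 2 * 2)) := by
          rw [ENNReal.ofReal_mul (by positivity), ENNReal.ofReal_add (by norm_num) (by positivity),
            ENNReal.ofReal_mul (by positivity)]
          simp
      _ ≤ _ := by
          rw [Real.exp_add]
          refine ENNReal.ofReal_le_ofReal ?_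
          gcongr
          have := Real.add_one_le_exp (2 * θ ^ 2)
          linarith
  have := lintegral_iSup_exp_sum_le (μ := μ.prod rademacher)
    (F := fun (_ : Unit) p => θ / R * (p.2 * ‖inner ℂ p.1 w‖ ^ 2))
    (G := fun _ _ => 2 * θ ^ 2) (fun _ => by fun_prop) (fun _ => by fun_prop) hone m 0
  simpa [signedForm, Finset.mul_sum] using this

theorem integrable_sq_of_mem_unitForms (hR : 0 < R)
    (hexp : ∀ v : EuclideanSpace ℂ (Fin n), ‖v‖ = 1 →
      ∫⁻ x, ENNReal.ofReal (Real.exp (‖inner ℂ v x‖ ^ 2 / R)) ∂μ ≤ 2)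
    {Y : EuclideanSpace ℂ (Fin n) → ℝ} (hY : Y ∈ unitForms n) :
    Integrable (fun x => Y x ^ 2) μ := by
  refine ((integrable_const (1 : ℝ)).add (integrable_and_integral_pow_six_le hR hexp hY).1).mono'
    ((measurable_of_mem_unitForms hY).pow_const 2).aestronglyMeasurable (ae_of_all _ fun x => ?_)
  rw [Real.norm_eq_abs, abs_of_nonneg (sq_nonneg _)]
  have e : Y x ^ 6 = (Y x ^ 2) ^ 3 := by ring
  simp only [Pi.add_apply]
  rw [e]
  nlinarith [sq_nonneg (Y x ^ 2 - 1), sq_nonneg (Y x),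
    mul_nonneg (sq_nonneg (Y x)) (sq_nonneg (Y x ^ 2 - 1))]

theorem integrable_of_mem_unitForms (hR : 0 < R)
    (hexp : ∀ v : EuclideanSpace ℂ (Fin n), ‖v‖ = 1 →
      ∫⁻ x, ENNReal.ofReal (Real.exp (‖inner ℂ v x‖ ^ 2 / R)) ∂μ ≤ 2)
    {Y : EuclideanSpace ℂ (Fin n) → ℝ} (hY : Y ∈ unitForms n) : Integrable Y μ := by
  refine ((integrable_const (1 : ℝ)).add (integrable_sq_of_mem_unitForms hR hexp hY)).mono'
    (measurable_of_mem_unitForms hY).aestronglyMeasurable (ae_of_all _ fun x => ?_)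
  simp only [Pi.add_apply, Real.norm_eq_abs]
  nlinarith [sq_nonneg (|Y x| - 1), sq_abs (Y x), abs_nonneg (Y x)]

theorem le_integral_abs_of_mem_unitForms (hR : 0 < R)
    (hexp : ∀ v : EuclideanSpace ℂ (Fin n), ‖v‖ = 1 →
      ∫⁻ x, ENNReal.ofReal (Real.exp (‖inner ℂ v x‖ ^ 2 / R)) ∂μ ≤ 2)
    {Y : EuclideanSpace ℂ (Fin n) → ℝ} (hY : Y ∈ unitForms n) {t : ℝ} (ht : 0 < t) :
    (∫ x, Y x ^ 2 ∂μ) / t - 1440 * R ^ 6 / t ^ 5 ≤ ∫ x, |Y x| ∂μ := by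
  obtain ⟨h6, h6'⟩ := integrable_and_integral_pow_six_le hR hexp hY
  have h2 := integrable_sq_of_mem_unitForms hR hexp hY
  have h := integral_mono ((h2.div_const t).sub (h6.div_const (t ^ 5)))
    (integrable_of_mem_unitForms hR hexp hY).abs fun x => sq_div_sub_pow_div_le_abs ht (Y x)
  simp only [Pi.sub_apply] at h
  rw [integral_sub (h2.div_const t) (h6.div_const (t ^ 5)), integral_div, integral_div] at h
  have : (∫ x, Y x ^ 6 ∂μ) / t ^ 5 ≤ 1440 * R ^ 6 / t ^ 5 := by gcongr
  linarith

/-- The uniform lower bound for the empirical first moments of a countable family of forms. -/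
theorem measure_exists_sum_abs_lt_le (hR : 0 < R)
    (hexp : ∀ v : EuclideanSpace ℂ (Fin n), ‖v‖ = 1 →
      ∫⁻ x, ENNReal.ofReal (Real.exp (‖inner ℂ v x‖ ^ 2 / R)) ∂μ ≤ 2)
    {ι : Type*} [Countable ι] {Y : ι → EuclideanSpace ℂ (Fin n) → ℝ}
    (hY : ∀ t, Y t ∈ unitForms n) {b : ℝ} (hb0 : 0 ≤ b) (hbR : b ≤ 256 * R)
    (hb : ∀ t, 2 * b ≤ ∫ x, |Y t x| ∂μ) (m : ℕ) :
    Measure.pi (fun _ : Fin m => μ) {x | ∃ t, ∑ i, |Y t (x i)| < m * b}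
      ≤ ENNReal.ofReal (2 * 25 ^ n * Real.exp (-(m * b ^ 2 / (32768 * R ^ 2)))) := by
  rcases isEmpty_or_nonempty ι with hι | hι
  · simp
  obtain ⟨s, hs1, hs, hcard⟩ := exists_net_unit_sphere n
  have hYm : ∀ t, Measurable (Y t) := fun t => measurable_of_mem_unitForms (hY t)
  -- `a` minimizes the exponent `-a * (m * b) + m * (2 * θ ^ 2)` below, where `θ = 64 * a * R`.
  set a : ℝ := b / (16384 * R ^ 2) with ha
  have ha0 : 0 ≤ a := by positivity
  have haR : |64 * a * R| ≤ 1 := by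
    rw [abs_of_nonneg (by positivity), ha]
    rw [show 64 * (b / (16384 * R ^ 2)) * R = b / (256 * R) by field_simp; ring]
    exact div_le_one_of_le₀ hbR (by positivity)
  have hsym := lintegral_iSup_exp_sum_le (μ := μ) (ν := μ.prod rademacher)
    (F := fun t x => ∫ z, |a * Y t z| ∂μ - |a * Y t x|)
    (G := fun t p => 2 * (p.2 * (a * Y t p.1)))
    (fun t => by fun_prop) (fun t => by fun_prop)
    (lintegral_iSup_exp_integral_abs_sub_le (fun t => by fun_prop)
      fun t => (integrable_of_mem_unitForms hR hexp (hY t)).const_mul a) m 0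
  have hnet : ∫⁻ p, ⨆ t, ENNReal.ofReal (Real.exp ((0 : ι → ℝ) t +
      ∑ i, 2 * ((p i).2 * (a * Y t (p i).1)))) ∂Measure.pi (fun _ : Fin m => μ.prod rademacher)
      ≤ ENNReal.ofReal (2 * 25 ^ n * Real.exp (m * (2 * (64 * a * R) ^ 2))) := by
    calc _ ≤ ∫⁻ p, ∑ w ∈ s, (ENNReal.ofReal (Real.exp ((64 * a * R) / R *
            signedForm (fun i => (p i).1) (fun i => (p i).2) w)) +
          ENNReal.ofReal (Real.exp ((-(64 * a * R)) / R *
            signedForm (fun i => (p i).1) (fun i => (p i).2) w)))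
          ∂Measure.pi (fun _ : Fin m => μ.prod rademacher) := by
          refine lintegral_mono fun p => iSup_le fun t => ?_
          have h := exp_sum_mul_le_sum_net hs1 hs (fun i => (p i).1) (fun i => (p i).2)
            (by positivity : 0 ≤ 2 * a) (hY t)
          have e1 : (0 : ι → ℝ) t + ∑ i, 2 * ((p i).2 * (a * Y t (p i).1)) =
              2 * a * ∑ i, (p i).2 * Y t (p i).1 := by
            rw [Pi.zero_apply, zero_add, Finset.mul_sum]
            exact Finset.sum_congr rfl fun i _ => by ring
          have e2 : 32 * (2 * a) = 64 * a * R / R := by field_simp; ring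
          have e3 : -(32 * (2 * a)) = -(64 * a * R) / R := by rw [e2]; ring
          rw [e1]
          refine (ENNReal.ofReal_le_ofReal h).trans_eq ?_
          rw [ENNReal.ofReal_sum_of_nonneg fun w _ => by positivity]
          refine Finset.sum_congr rfl fun w _ => ?_
          rw [ENNReal.ofReal_add (by positivity) (by positivity), e3, e2]
      _ ≤ ∑ w ∈ s, (ENNReal.ofReal (Real.exp (m * (2 * (64 * a * R) ^ 2))) +
          ENNReal.ofReal (Real.exp (m * (2 * (64 * a * R) ^ 2)))) := by
          have hmeas : ∀ (θ : ℝ) (w : EuclideanSpace ℂ (Fin n)),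
              Measurable fun p : Fin m → EuclideanSpace ℂ (Fin n) × ℝ => ENNReal.ofReal (Real.exp
                (θ / R * signedForm (fun i => (p i).1) (fun i => (p i).2) w)) := fun θ w => by
            unfold signedForm; fun_prop
          rw [lintegral_finsetSum s fun w _ =>
            (hmeas (64 * a * R) w).fun_add (hmeas (-(64 * a * R)) w)]
          refine Finset.sum_le_sum fun w hw => ?_
          rw [lintegral_add_left (hmeas _ w)]
          refine add_le_add (lintegral_exp_signed_le hR (hexp w (hs1 w hw)) haR m) ?_
          have := lintegral_exp_signed_le hR (hexp w (hs1 w hw)) (θ := -(64 * a * R))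
            (by rwa [abs_neg]) m
          rwa [neg_sq] at this
      _ ≤ _ := by
          rw [Finset.sum_const, ← two_mul, nsmul_eq_mul, ENNReal.ofReal_mul (by positivity),
            ENNReal.ofReal_mul (by norm_num), ← mul_assoc, mul_comm (s.card : ℝ≥0∞)]
          have hc : (s.card : ℝ≥0∞) ≤ ENNReal.ofReal (25 ^ n) := by
            rw [← ENNReal.ofReal_natCast]
            exact ENNReal.ofReal_le_ofReal (by exact_mod_cast hcard)
          rw [show ENNReal.ofReal 2 = 2 by simp]
          gcongr
  have hLm : Measurable fun x : Fin m → EuclideanSpace ℂ (Fin n) => ⨆ t, ENNReal.ofReal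
      (Real.exp ((0 : ι → ℝ) t + ∑ i, (∫ z, |a * Y t z| ∂μ - |a * Y t (x i)|))) :=
    Measurable.iSup fun t => by
      have := hYm t
      fun_prop
  have hmarkov := mul_meas_ge_le_lintegral₀ (μ := Measure.pi (fun _ : Fin m => μ))
    (f := fun x => ⨆ t, ENNReal.ofReal (Real.exp ((0 : ι → ℝ) t +
      ∑ i, (∫ z, |a * Y t z| ∂μ - |a * Y t (x i)|)))) hLm.aemeasurable
    (ENNReal.ofReal (Real.exp (a * (m * b))))
  have hsub : {x : Fin m → EuclideanSpace ℂ (Fin n) | ∃ t, ∑ i, |Y t (x i)| < m * b} ⊆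
      {x | ENNReal.ofReal (Real.exp (a * (m * b))) ≤ ⨆ t, ENNReal.ofReal (Real.exp
        ((0 : ι → ℝ) t + ∑ i, (∫ z, |a * Y t z| ∂μ - |a * Y t (x i)|)))} := by
    rintro x ⟨t, ht⟩
    refine le_trans (ENNReal.ofReal_le_ofReal (Real.exp_le_exp.2 ?_))
      (le_iSup (fun t => ENNReal.ofReal (Real.exp ((0 : ι → ℝ) t +
        ∑ i, (∫ z, |a * Y t z| ∂μ - |a * Y t (x i)|)))) t)
    simp only [Pi.zero_apply, zero_add, abs_mul, abs_of_nonneg ha0, integral_const_mul,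
      Finset.sum_sub_distrib, Finset.sum_const, Finset.card_univ, Fintype.card_fin, nsmul_eq_mul,
      ← Finset.mul_sum]
    have h1 : (m : ℝ) * (2 * b) ≤ m * ∫ x, |Y t x| ∂μ := by gcongr; exact hb t
    nlinarith
  have hfin := (mul_le_mul_right (measure_mono hsub) _).trans (hmarkov.trans (hsym.trans hnet))
  have hpos : 0 < Real.exp (a * (m * b)) := Real.exp_pos _
  rw [mul_comm, ← ENNReal.le_div_iff_mul_le (by simp [hpos]) (by simp)] at hfin
  refine hfin.trans_eq ?_
  rw [← ENNReal.ofReal_div_of_pos hpos, mul_div_assoc, ← Real.exp_sub]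
  congr 3
  rw [ha]
  field_simp
  ring

end Moments

/-! ### The second moment of a real quadratic form -/

section Variance

variable {Ω : Type*} {n : ℕ}

/-- The centred products `Re (conj Z_j * Z_k) - δ_jk`, an orthogonal system up to the symmetry in
`(j, k)`. -/
noncomputable def centredProd (Z : Fin n → Ω → ℂ) (a : Fin n × Fin n) (ω : Ω) : ℝ :=
  ((Z a.1 ω).re * (Z a.2 ω).re + (Z a.1 ω).im * (Z a.2 ω).im) - if a.1 = a.2 then 1 else 0

theorem centredProd_swap (Z : Fin n → Ω → ℂ) (j k : Fin n) :
    centredProd Z (k, j) = centredProd Z (j, k) := by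
  ext ω
  simp only [centredProd, eq_comm (a := k)]
  ring

variable [MeasurableSpace Ω] {P : Measure Ω} {Z : Fin n → Ω → ℂ}

theorem measurable_centredProd (hZ : ∀ j, Measurable (Z j)) (a : Fin n × Fin n) :
    Measurable (centredProd Z a) := by
  unfold centredProd
  have := hZ a.1
  have := hZ a.2
  fun_prop

theorem memLp_two_mul [IsFiniteMeasure P] (hZ : ∀ j, Measurable (Z j))
    (h4 : ∀ j, Integrable (fun ω => ‖Z j ω‖ ^ 4) P) (f g : ℂ → ℝ) (hf : Measurable f)
    (hg : Measurable g) (hf' : ∀ z, |f z| ≤ ‖z‖) (hg' : ∀ z, |g z| ≤ ‖z‖) (j k : Fin n) :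
    MemLp (fun ω => f (Z j ω) * g (Z k ω)) 2 P := by
  have hm : Measurable fun ω => f (Z j ω) * g (Z k ω) :=
    (hf.comp (hZ j)).mul (hg.comp (hZ k))
  rw [memLp_two_iff_integrable_sq hm.aestronglyMeasurable]
  refine ((h4 j).add (h4 k)).mono' (hm.pow_const 2).aestronglyMeasurable (ae_of_all _ fun ω => ?_)
  rw [Real.norm_eq_abs, abs_of_nonneg (sq_nonneg _), mul_pow, ← sq_abs (f _), ← sq_abs (g _)]
  simp only [Pi.add_apply]
  have h1 : |f (Z j ω)| ^ 2 ≤ ‖Z j ω‖ ^ 2 := by gcongr; exact hf' _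
  have h2 : |g (Z k ω)| ^ 2 ≤ ‖Z k ω‖ ^ 2 := by gcongr; exact hg' _
  have h3 := mul_le_mul h1 h2 (sq_nonneg _) (sq_nonneg _)
  nlinarith [sq_nonneg (‖Z j ω‖ ^ 2 - ‖Z k ω‖ ^ 2), sq_nonneg (‖Z j ω‖ ^ 2),
    sq_nonneg (‖Z k ω‖ ^ 2)]

theorem memLp_two_centredProd [IsFiniteMeasure P] (hZ : ∀ j, Measurable (Z j))
    (h4 : ∀ j, Integrable (fun ω => ‖Z j ω‖ ^ 4) P) (a : Fin n × Fin n) :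
    MemLp (centredProd Z a) 2 P :=
  ((memLp_two_mul hZ h4 _ _ Complex.measurable_re Complex.measurable_re Complex.abs_re_le_norm
    Complex.abs_re_le_norm a.1 a.2).add (memLp_two_mul hZ h4 _ _ Complex.measurable_im
    Complex.measurable_im Complex.abs_im_le_norm Complex.abs_im_le_norm a.1 a.2)).sub
    (memLp_const _)

theorem integral_re_eq_zero_and_integral_im_eq_zero {X : Ω → ℂ} (hX : Integrable X P)
    (h0 : ∫ ω, X ω ∂P = 0) : ∫ ω, (X ω).re ∂P = 0 ∧ ∫ ω, (X ω).im ∂P = 0 := by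
  have h1 := integral_re hX
  have h2 := integral_im hX
  simp only [RCLike.re_eq_complex_re, RCLike.im_eq_complex_im] at h1 h2
  rw [h1, h2, h0]
  simp

theorem integral_sq_centredProd_offDiag_ge (hZ : ∀ j, Measurable (Z j)) (hind : iIndepFun Z P)
    (hid : ∀ j k, IdentDistrib (Z j) (Z k) P P) (h1 : ∀ j, ∫ ω, ‖Z j ω‖ ^ 2 ∂P = 1)
    {j k : Fin n} (hjk : j ≠ k) :
    1 / 2 ≤ ∫ ω, centredProd Z (j, k) ω * centredProd Z (j, k) ω ∂P := by
  -- `(Re w) ^ 2 = (|w| ^ 2 + Re (w ^ 2)) / 2`, and the mean of `w ^ 2` is `|E Z ^ 2| ^ 2`.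
  have e : ∀ ω, centredProd Z (j, k) ω * centredProd Z (j, k) ω =
      1 / 2 * (‖Z j ω‖ ^ 2 * ‖Z k ω‖ ^ 2 + ((Z j ω ^ 2).re * (Z k ω ^ 2).re
        + (Z j ω ^ 2).im * (Z k ω ^ 2).im)) := fun ω => by
    rw [← Complex.normSq_eq_norm_sq, ← Complex.normSq_eq_norm_sq, Complex.normSq_apply,
      Complex.normSq_apply]
    simp only [centredProd, hjk, if_false, pow_two, Complex.mul_re, Complex.mul_im]
    ring
  have hsq : ∀ j, Integrable (fun ω => ‖Z j ω‖ ^ 2) P := fun j => by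
    by_contra h
    have := h1 j
    rw [integral_undef h] at this
    exact zero_ne_one this
  have hI2 : ∀ f : ℂ → ℝ, Measurable f → (∀ z, |f z| ≤ ‖z‖ ^ 2) →
      ∀ j, Integrable (fun ω => f (Z j ω)) P := fun f hf hf' j =>
    (hsq j).mono' (hf.comp (hZ j)).aestronglyMeasurable (ae_of_all _ fun ω => hf' _)
  have hmul : ∀ f : ℂ → ℝ, Measurable f → (∀ z, |f z| ≤ ‖z‖ ^ 2) →
      Integrable (fun ω => f (Z j ω) * f (Z k ω)) P ∧
      ∫ ω, f (Z j ω) * f (Z k ω) ∂P = (∫ ω, f (Z j ω) ∂P) ^ 2 := by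
    intro f hf hf'
    have hi := (hind.indepFun hjk).comp hf hf
    refine ⟨hi.integrable_mul (hI2 f hf hf' j) (hI2 f hf hf' k), ?_⟩
    have h := hi.integral_fun_mul_eq_mul_integral
      (hf.comp (hZ j)).aestronglyMeasurable (hf.comp (hZ k)).aestronglyMeasurable
    simp only [Function.comp_apply] at h
    have h' := ((hid k j).comp hf).integral_eq
    simp only [Function.comp_apply] at h'
    rw [h, h', pow_two]
  obtain ⟨a1, a2⟩ := hmul (fun z => ‖z‖ ^ 2) (by fun_prop) fun z => by
    rw [abs_of_nonneg (sq_nonneg _)]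
  obtain ⟨b1, b2⟩ := hmul (fun z => (z ^ 2).re) (by fun_prop) fun z => by
    rw [← norm_pow]; exact Complex.abs_re_le_norm _
  obtain ⟨c1, c2⟩ := hmul (fun z => (z ^ 2).im) (by fun_prop) fun z => by
    rw [← norm_pow]; exact Complex.abs_im_le_norm _
  simp only [e]
  rw [integral_const_mul, integral_add a1 (b1.fun_add c1), integral_add b1 c1, a2, b2, c2, h1]
  nlinarith [sq_nonneg (∫ ω, (Z j ω ^ 2).re ∂P), sq_nonneg (∫ ω, (Z j ω ^ 2).im ∂P)]

variable [IsProbabilityMeasure P]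

theorem integrable_of_integrable_norm_pow_four {X : Ω → ℂ} (hX : Measurable X)
    (h4 : Integrable (fun ω => ‖X ω‖ ^ 4) P) : Integrable X P := by
  refine ((integrable_const (1 : ℝ)).add h4).mono' hX.aestronglyMeasurable
    (ae_of_all _ fun ω => ?_)
  simp only [Pi.add_apply]
  nlinarith [sq_nonneg (‖X ω‖ - 1), sq_nonneg (‖X ω‖ ^ 2 - 1), norm_nonneg (X ω)]

theorem integral_centredProd_mul_eq_zero (hZ : ∀ j, Measurable (Z j)) (hind : iIndepFun Z P)
    (h0 : ∀ j, ∫ ω, Z j ω ∂P = 0) (h4 : ∀ j, Integrable (fun ω => ‖Z j ω‖ ^ 4) P)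
    {j k l m : Fin n} (hk : j ≠ k) (hl : j ≠ l) (hm : j ≠ m) :
    ∫ ω, centredProd Z (j, k) ω * centredProd Z (l, m) ω ∂P = 0 := by
  classical
  have hindep := hind.indepFun_finset {j} {k, l, m} (by simp [hk, hl, hm]) hZ
  have hj : j ∈ ({j} : Finset (Fin n)) := by simp
  have hk' : k ∈ ({k, l, m} : Finset (Fin n)) := by simp
  have hl' : l ∈ ({k, l, m} : Finset (Fin n)) := by simp
  have hm' : m ∈ ({k, l, m} : Finset (Fin n)) := by simp
  have hz := integral_re_eq_zero_and_integral_im_eq_zero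
    (integrable_of_integrable_norm_pow_four (hZ j) (h4 j)) (h0 j)
  have key : ∀ f : ℂ → ℝ, Measurable f → ∫ ω, f (Z j ω) ∂P = 0 →
      ∫ ω, f (Z j ω) * (f (Z k ω) * centredProd Z (l, m) ω) ∂P = 0 := by
    intro f hf hf0
    have hφ : Measurable fun x : ({j} : Finset (Fin n)) → ℂ => f (x ⟨j, hj⟩) := by fun_prop
    have hψ : Measurable fun y : ({k, l, m} : Finset (Fin n)) → ℂ =>
        f (y ⟨k, hk'⟩) * (((y ⟨l, hl'⟩).re * (y ⟨m, hm'⟩).re + (y ⟨l, hl'⟩).im * (y ⟨m, hm'⟩).im)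
          - if l = m then 1 else 0) := by fun_prop
    have h := (hindep.comp hφ hψ).integral_fun_mul_eq_mul_integral
      (hf.comp (hZ j)).aestronglyMeasurable
      ((hf.comp (hZ k)).mul (measurable_centredProd hZ (l, m))).aestronglyMeasurable
    simp only [Function.comp_apply] at h
    rw [hf0, zero_mul] at h
    exact h
  have hG := memLp_two_centredProd hZ h4 (l, m)
  have hI1 := (memLp_two_mul hZ h4 _ _ Complex.measurable_re Complex.measurable_re
    Complex.abs_re_le_norm Complex.abs_re_le_norm j k).integrable_mul hG
  have hI2 := (memLp_two_mul hZ h4 _ _ Complex.measurable_im Complex.measurable_im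
    Complex.abs_im_le_norm Complex.abs_im_le_norm j k).integrable_mul hG
  have e : ∀ ω, centredProd Z (j, k) ω * centredProd Z (l, m) ω =
      (Z j ω).re * ((Z k ω).re * centredProd Z (l, m) ω) +
      (Z j ω).im * ((Z k ω).im * centredProd Z (l, m) ω) := fun ω => by
    conv_lhs => rw [centredProd]
    simp only [hk, if_false]
    ring
  simp only [e]
  rw [integral_add (hI1.congr (ae_of_all _ fun ω => by simp [mul_assoc]))
    (hI2.congr (ae_of_all _ fun ω => by simp [mul_assoc])), key _ Complex.measurable_re hz.1,
    key _ Complex.measurable_im hz.2, add_zero]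

theorem integral_centredProd (hZ : ∀ j, Measurable (Z j)) (hind : iIndepFun Z P)
    (h0 : ∀ j, ∫ ω, Z j ω ∂P = 0) (h1 : ∀ j, ∫ ω, ‖Z j ω‖ ^ 2 ∂P = 1)
    (h4 : ∀ j, Integrable (fun ω => ‖Z j ω‖ ^ 4) P) (a : Fin n × Fin n) :
    ∫ ω, centredProd Z a ω ∂P = 0 := by
  obtain ⟨j, k⟩ := a
  have hre := memLp_two_mul hZ h4 _ _ Complex.measurable_re Complex.measurable_re
    Complex.abs_re_le_norm Complex.abs_re_le_norm j k
  have him := memLp_two_mul hZ h4 _ _ Complex.measurable_im Complex.measurable_im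
    Complex.abs_im_le_norm Complex.abs_im_le_norm j k
  by_cases hjk : j = k
  · subst hjk
    have e : ∀ ω, centredProd Z (j, j) ω = ‖Z j ω‖ ^ 2 - 1 := fun ω => by
      rw [← Complex.normSq_eq_norm_sq, Complex.normSq_apply]
      simp [centredProd]
    simp only [e]
    have hI : Integrable (fun ω => ‖Z j ω‖ ^ 2) P := by
      by_contra h
      have := h1 j
      rw [integral_undef h] at this
      exact zero_ne_one this
    rw [integral_sub hI (integrable_const _), h1]
    simp
  · have hz := integral_re_eq_zero_and_integral_im_eq_zero
      (integrable_of_integrable_norm_pow_four (hZ j) (h4 j)) (h0 j)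
    have hp : ∀ f : ℂ → ℝ, Measurable f → ∫ ω, f (Z j ω) ∂P = 0 →
        ∫ ω, f (Z j ω) * f (Z k ω) ∂P = 0 := fun f hf hf0 => by
      have h := ((hind.indepFun hjk).comp hf hf).integral_fun_mul_eq_mul_integral
        (hf.comp (hZ j)).aestronglyMeasurable (hf.comp (hZ k)).aestronglyMeasurable
      simp only [Function.comp_apply] at h
      rw [h, hf0, zero_mul]
    simp only [centredProd, hjk, if_false, sub_zero]
    rw [integral_add (hre.integrable (by norm_num)) (him.integrable (by norm_num)),
      hp _ Complex.measurable_re hz.1, hp _ Complex.measurable_im hz.2, add_zero]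

theorem integral_centredProd_diag_mul_eq_zero (hZ : ∀ j, Measurable (Z j)) (hind : iIndepFun Z P)
    (h0 : ∀ j, ∫ ω, Z j ω ∂P = 0) (h1 : ∀ j, ∫ ω, ‖Z j ω‖ ^ 2 ∂P = 1)
    (h4 : ∀ j, Integrable (fun ω => ‖Z j ω‖ ^ 4) P) {j l : Fin n} (hjl : j ≠ l) :
    ∫ ω, centredProd Z (j, j) ω * centredProd Z (l, l) ω ∂P = 0 := by
  have hφ : Measurable fun z : ℂ => (z.re * z.re + z.im * z.im) - 1 := by fun_prop
  have h := ((hind.indepFun hjl).comp hφ hφ).integral_fun_mul_eq_mul_integral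
    (hφ.comp (hZ j)).aestronglyMeasurable (hφ.comp (hZ l)).aestronglyMeasurable
  have hj := integral_centredProd hZ hind h0 h1 h4 (j, j)
  simp only [centredProd, if_true] at hj ⊢
  simp only [Function.comp_apply] at h
  rw [h, hj, zero_mul]

theorem integral_sq_centredProd_diag_ge
    (h1 : ∀ j, ∫ ω, ‖Z j ω‖ ^ 2 ∂P = 1)
    (h4 : ∀ j, Integrable (fun ω => ‖Z j ω‖ ^ 4) P) {κ : ℝ}
    (hκ : ∀ j, 1 + κ ≤ ∫ ω, ‖Z j ω‖ ^ 4 ∂P) (j : Fin n) :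
    κ ≤ ∫ ω, centredProd Z (j, j) ω * centredProd Z (j, j) ω ∂P := by
  have e : ∀ ω, centredProd Z (j, j) ω * centredProd Z (j, j) ω =
      ‖Z j ω‖ ^ 4 - 2 * ‖Z j ω‖ ^ 2 + 1 := fun ω => by
    rw [show ‖Z j ω‖ ^ 4 = (‖Z j ω‖ ^ 2) ^ 2 by ring, ← Complex.normSq_eq_norm_sq,
      Complex.normSq_apply]
    simp only [centredProd, if_true]
    ring
  have hI : Integrable (fun ω => ‖Z j ω‖ ^ 2) P := by
    by_contra h
    have := h1 j
    rw [integral_undef h] at this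
    exact zero_ne_one this
  simp only [e]
  have hA : Integrable (fun ω => ‖Z j ω‖ ^ 4 - 2 * ‖Z j ω‖ ^ 2) P := (h4 j).sub (hI.const_mul 2)
  rw [integral_add hA (integrable_const _),
    integral_sub (h4 j) (hI.const_mul 2), integral_const_mul, h1]
  simp only [integral_const, probReal_univ, smul_eq_mul, mul_one]
  linarith [hκ j]

/-- The second moment of `Z* h Z` for a real symmetric matrix `h` and a vector `Z` with i.i.d.
standardized entries. -/
theorem le_integral_sq_sum (hZ : ∀ j, Measurable (Z j)) (hind : iIndepFun Z P)
    (hid : ∀ j k, IdentDistrib (Z j) (Z k) P P) (h0 : ∀ j, ∫ ω, Z j ω ∂P = 0)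
    (h1 : ∀ j, ∫ ω, ‖Z j ω‖ ^ 2 ∂P = 1) (h4 : ∀ j, Integrable (fun ω => ‖Z j ω‖ ^ 4) P) {κ : ℝ}
    (hκ : ∀ j, 1 + κ ≤ ∫ ω, ‖Z j ω‖ ^ 4 ∂P) {h : Fin n → Fin n → ℝ} (hsym : ∀ j k, h j k = h k j) :
    (∑ j, h j j) ^ 2 + ∑ j, ∑ k, (if j = k then κ else 1) * h j k ^ 2 ≤
      ∫ ω, (∑ j, ∑ k, h j k * ((Z j ω).re * (Z k ω).re + (Z j ω).im * (Z k ω).im)) ^ 2 ∂P := by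
  have hL := memLp_two_centredProd hZ h4
  have hGG : ∀ a b, Integrable (fun ω => centredProd Z a ω * centredProd Z b ω) P := fun a b =>
    (hL a).integrable_mul (hL b)
  have hG : ∀ a, Integrable (centredProd Z a) P := fun a => (hL a).integrable (by norm_num)
  have hY : ∀ ω, ∑ j, ∑ k, h j k * ((Z j ω).re * (Z k ω).re + (Z j ω).im * (Z k ω).im) =
      (∑ j, h j j) + ∑ a : Fin n × Fin n, h a.1 a.2 * centredProd Z a ω := fun ω => by
    rw [Fintype.sum_prod_type, ← Finset.sum_add_distrib]
    refine Finset.sum_congr rfl fun j _ => ?_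
    simp only [centredProd, mul_sub, Finset.sum_sub_distrib]
    simp
  have hsq : ∀ ω, (∑ j, ∑ k, h j k * ((Z j ω).re * (Z k ω).re + (Z j ω).im * (Z k ω).im)) ^ 2 =
      ((∑ j, h j j) ^ 2 + ∑ a : Fin n × Fin n, (2 * (∑ j, h j j) * h a.1 a.2) * centredProd Z a ω) +
      ∑ a : Fin n × Fin n, ∑ b : Fin n × Fin n, (h a.1 a.2 * h b.1 b.2) *
        (centredProd Z a ω * centredProd Z b ω) := fun ω => by
    have e1 : ∑ a : Fin n × Fin n, (2 * (∑ j, h j j) * h a.1 a.2) * centredProd Z a ω =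
        2 * (∑ j, h j j) * ∑ a : Fin n × Fin n, h a.1 a.2 * centredProd Z a ω := by
      rw [Finset.mul_sum Finset.univ fun a : Fin n × Fin n => h a.1 a.2 * centredProd Z a ω]
      exact Finset.sum_congr rfl fun a _ => by ring
    have e2 : ∑ a : Fin n × Fin n, ∑ b : Fin n × Fin n, (h a.1 a.2 * h b.1 b.2) *
        (centredProd Z a ω * centredProd Z b ω) =
        (∑ a : Fin n × Fin n, h a.1 a.2 * centredProd Z a ω) ^ 2 := by
      rw [pow_two, Finset.sum_mul_sum]
      exact Finset.sum_congr rfl fun a _ => Finset.sum_congr rfl fun b _ => by ring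
    rw [hY, e1, e2]
    ring
  have hI1 : Integrable (fun ω => (∑ j, h j j) ^ 2 +
      ∑ a : Fin n × Fin n, (2 * (∑ j, h j j) * h a.1 a.2) * centredProd Z a ω) P :=
    (integrable_const _).add (integrable_finsetSum _ fun a _ => (hG a).const_mul _)
  simp only [hsq]
  rw [integral_add hI1 (integrable_finsetSum _ fun a _ => integrable_finsetSum _ fun b _ =>
    (hGG a b).const_mul _), integral_add (integrable_const _)
    (integrable_finsetSum _ fun a _ => (hG a).const_mul _),
    integral_finsetSum _ fun a _ => (hG a).const_mul _,
    integral_finsetSum _ fun a _ => integrable_finsetSum _ fun b _ => (hGG a b).const_mul _]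
  simp only [integral_const_mul, integral_centredProd hZ hind h0 h1 h4, mul_zero,
    Finset.sum_const_zero, add_zero, integral_const, probReal_univ, smul_eq_mul, one_mul]
  rw [← Fintype.sum_prod_type' fun j k => (if j = k then κ else 1) * h j k ^ 2]
  refine add_le_add_right (Finset.sum_le_sum fun a _ => ?_) _
  rw [integral_finsetSum _ fun b _ => (hGG a b).const_mul _]
  simp only [integral_const_mul]
  obtain ⟨j, k⟩ := a
  by_cases hjk : j = k
  · subst hjk
    rw [Fintype.sum_eq_single (j, j)]
    · have := integral_sq_centredProd_diag_ge h1 h4 hκ j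
      simp only [if_true]
      nlinarith [sq_nonneg (h j j)]
    · rintro ⟨l, m⟩ hb
      refine mul_eq_zero_of_right _ ?_
      by_cases hlm : l = m
      · subst hlm
        exact integral_centredProd_diag_mul_eq_zero hZ hind h0 h1 h4 fun hjl => hb (by rw [hjl])
      · simp only [mul_comm (centredProd Z (j, j) _)]
        by_cases hlj : l = j
        · rw [← centredProd_swap]
          exact integral_centredProd_mul_eq_zero hZ hind h0 h4 (Ne.symm hlm)
            (fun hmj => hlm (hlj.trans hmj.symm)) fun hmj => hlm (hlj.trans hmj.symm)
        · exact integral_centredProd_mul_eq_zero hZ hind h0 h4 hlm hlj hlj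
  · rw [Fintype.sum_eq_add (j, k) (k, j) (by simpa using fun h => absurd h hjk)]
    · have := integral_sq_centredProd_offDiag_ge hZ hind hid h1 hjk
      simp only [centredProd_swap Z j k, hjk, if_false, hsym k j]
      nlinarith [sq_nonneg (h j k)]
    · rintro ⟨l, m⟩ ⟨hb1, hb2⟩
      refine mul_eq_zero_of_right _ ?_
      by_cases hj : j ≠ l ∧ j ≠ m
      · exact integral_centredProd_mul_eq_zero hZ hind h0 h4 hjk hj.1 hj.2
      · rw [← centredProd_swap]
        refine integral_centredProd_mul_eq_zero hZ hind h0 h4 (Ne.symm hjk) ?_ ?_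
        · rintro rfl
          refine hj ⟨hjk, ?_⟩
          rintro rfl
          exact hb2 rfl
        · rintro rfl
          refine hj ⟨?_, hjk⟩
          rintro rfl
          exact hb1 rfl

end Variance

/-! ### Spectral decomposition and the descent directions of the program -/

section Descent

variable {n : ℕ}

/-- The real quadratic form `x ↦ x* Z x` measured by `measOp`. -/
noncomputable def quadForm (Z : Matrix (Fin n) (Fin n) ℂ) (x : EuclideanSpace ℂ (Fin n)) : ℝ :=
  ((lift x)ᴴ * Z).trace.re

theorem quadForm_eq_sum (Z : Matrix (Fin n) (Fin n) ℂ) (x : EuclideanSpace ℂ (Fin n)) :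
    quadForm Z x = (∑ j, ∑ k, star (x j) * Z j k * x k).re := by
  rw [quadForm, Matrix.trace, Finset.sum_comm]
  congr 1
  refine Finset.sum_congr rfl fun j _ => ?_
  rw [Matrix.diag_apply, Matrix.mul_apply]
  refine Finset.sum_congr rfl fun k _ => ?_
  simp [lift, Matrix.conjTranspose_apply, Matrix.vecMulVec_apply]
  ring

theorem inner_toEuclideanLin_eq_sum (Z : Matrix (Fin n) (Fin n) ℂ)
    (a b : EuclideanSpace ℂ (Fin n)) :
    inner ℂ a (Matrix.toEuclideanLin Z b) = ∑ j, ∑ k, star (a j) * Z j k * b k := by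
  rw [PiLp.inner_apply]
  refine Finset.sum_congr rfl fun j _ => ?_
  simp only [Matrix.toLpLin_apply, Matrix.mulVec, dotProduct, RCLike.inner_apply, Finset.sum_mul,
    RCLike.star_def]
  exact Finset.sum_congr rfl fun k _ => by ring

theorem quadForm_eq_inner (Z : Matrix (Fin n) (Fin n) ℂ) (x : EuclideanSpace ℂ (Fin n)) :
    quadForm Z x = (inner ℂ x (Matrix.toEuclideanLin Z x)).re := by
  rw [quadForm_eq_sum, inner_toEuclideanLin_eq_sum]

theorem quadForm_smul (r : ℝ) (Z : Matrix (Fin n) (Fin n) ℂ) (x : EuclideanSpace ℂ (Fin n)) :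
    quadForm (r • Z) x = r * quadForm Z x := by
  simp [quadForm, Matrix.trace_smul]

theorem quadForm_sub (Z W : Matrix (Fin n) (Fin n) ℂ) (x : EuclideanSpace ℂ (Fin n)) :
    quadForm (Z - W) x = quadForm Z x - quadForm W x := by
  simp [quadForm, mul_sub]

theorem quadForm_lift (a x : EuclideanSpace ℂ (Fin n)) :
    quadForm (lift a) x = ‖inner ℂ x a‖ ^ 2 := by
  rw [quadForm_eq_sum]
  have h : ∑ j, ∑ k, star (x j) * lift a j k * x k = inner ℂ x a * star (inner ℂ x a) := by
    rw [PiLp.inner_apply, star_sum, Finset.sum_mul_sum]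
    refine Finset.sum_congr rfl fun j _ => Finset.sum_congr rfl fun k _ => ?_
    simp [lift, Matrix.vecMulVec_apply]
    ring
  rw [h]
  have := Complex.mul_conj (inner ℂ x a)
  rw [← starRingEnd_apply, this, Complex.ofReal_re, Complex.normSq_eq_norm_sq]

theorem inner_toEuclideanLin_eq_sum_eigenvalues {H : Matrix (Fin n) (Fin n) ℂ}
    (hH : H.IsHermitian) (a b : EuclideanSpace ℂ (Fin n)) :
    inner ℂ a (Matrix.toEuclideanLin H b) = ∑ k, (hH.eigenvalues k : ℂ) *
      (inner ℂ a (hH.eigenvectorBasis k) * inner ℂ (hH.eigenvectorBasis k) b) := by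
  have hev : ∀ k, Matrix.toEuclideanLin H (hH.eigenvectorBasis k) =
      (hH.eigenvalues k : ℂ) • hH.eigenvectorBasis k := fun k => by
    ext j
    have := congrFun (hH.mulVec_eigenvectorBasis k) j
    simpa [Matrix.toLpLin_apply] using this
  have hs := Matrix.isSymmetric_toEuclideanLin_iff.2 hH
  rw [← hH.eigenvectorBasis.sum_inner_mul_inner a]
  refine Finset.sum_congr rfl fun k _ => ?_
  rw [← hs, hev, inner_smul_left, Complex.conj_ofReal]
  ring

theorem quadForm_eq_sum_eigenvalues {H : Matrix (Fin n) (Fin n) ℂ} (hH : H.IsHermitian)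
    (x : EuclideanSpace ℂ (Fin n)) :
    quadForm H x = ∑ k, hH.eigenvalues k * ‖inner ℂ (hH.eigenvectorBasis k) x‖ ^ 2 := by
  rw [quadForm_eq_inner, inner_toEuclideanLin_eq_sum_eigenvalues hH, Complex.re_sum]
  refine Finset.sum_congr rfl fun k _ => ?_
  rw [Complex.re_ofReal_mul, ← inner_conj_symm x, mul_comm ((starRingEnd ℂ) _), Complex.mul_conj,
    Complex.ofReal_re, Complex.normSq_eq_norm_sq]

theorem quadForm_eigenvectorBasis {H : Matrix (Fin n) (Fin n) ℂ} (hH : H.IsHermitian) (k : Fin n) :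
    quadForm H (hH.eigenvectorBasis k) = hH.eigenvalues k := by
  rw [quadForm_eq_sum_eigenvalues hH, Fintype.sum_eq_single k]
  · simp
  · intro l hl
    rw [hH.eigenvectorBasis.orthonormal.2 hl]
    simp

theorem quadForm_smul_eigenvector_sub {H : Matrix (Fin n) (Fin n) ℂ} (hH : H.IsHermitian)
    {i j : Fin n} (hij : i ≠ j) (a b : ℂ) :
    quadForm H (a • hH.eigenvectorBasis i - b • hH.eigenvectorBasis j) =
      hH.eigenvalues i * ‖a‖ ^ 2 + hH.eigenvalues j * ‖b‖ ^ 2 := by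
  have ho := orthonormal_iff_ite.1 hH.eigenvectorBasis.orthonormal
  rw [quadForm_eq_sum_eigenvalues hH, Fintype.sum_eq_add i j hij]
  · simp only [inner_sub_right, inner_smul_right, ho]
    simp [hij, hij.symm]
  · rintro k ⟨hki, hkj⟩
    simp only [inner_sub_right, inner_smul_right, ho]
    simp [hki, hkj]

theorem norm_inner_toEuclideanLin_le {H : Matrix (Fin n) (Fin n) ℂ} (hH : H.IsHermitian)
    (a b : EuclideanSpace ℂ (Fin n)) :
    ‖inner ℂ a (Matrix.toEuclideanLin H b)‖ ≤ (∑ k, |hH.eigenvalues k|) * (‖a‖ * ‖b‖) := by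
  rw [inner_toEuclideanLin_eq_sum_eigenvalues hH, Finset.sum_mul]
  refine (norm_sum_le _ _).trans (Finset.sum_le_sum fun k _ => ?_)
  rw [norm_mul, norm_mul, Complex.norm_real, Real.norm_eq_abs]
  have h1 := norm_inner_le_norm (𝕜 := ℂ) a (hH.eigenvectorBasis k)
  have h2 := norm_inner_le_norm (𝕜 := ℂ) (hH.eigenvectorBasis k) b
  rw [hH.eigenvectorBasis.orthonormal.1 k] at h1 h2
  rw [mul_one] at h1
  rw [one_mul] at h2
  gcongr

/-- Cauchy–Schwarz: a quadratic form is bounded by the Frobenius norm of its matrix. -/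
theorem norm_sum_sq_le {E : Fin n → Fin n → ℂ} {a : EuclideanSpace ℂ (Fin n)} (ha : ‖a‖ = 1) :
    ‖∑ j, ∑ k, star (a j) * E j k * a k‖ ^ 2 ≤ ∑ j, ∑ k, ‖E j k‖ ^ 2 := by
  have hn : ∑ j, ‖a j‖ ^ 2 = 1 := by rw [← EuclideanSpace.norm_sq_eq, ha, one_pow]
  have h1 : ‖∑ j, ∑ k, star (a j) * E j k * a k‖ ≤
      ∑ p : Fin n × Fin n, ‖E p.1 p.2‖ * (‖a p.1‖ * ‖a p.2‖) := by
    rw [← Fintype.sum_prod_type' fun j k => star (a j) * E j k * a k]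
    refine (norm_sum_le _ _).trans (Finset.sum_le_sum fun p _ => le_of_eq ?_)
    rw [norm_mul, norm_mul, norm_star]
    ring
  have h2 := Finset.sum_mul_sq_le_sq_mul_sq Finset.univ
    (fun p : Fin n × Fin n => ‖E p.1 p.2‖) fun p => ‖a p.1‖ * ‖a p.2‖
  have h3 : ∑ p : Fin n × Fin n, (‖a p.1‖ * ‖a p.2‖) ^ 2 = 1 := by
    rw [Fintype.sum_prod_type]
    simp only [mul_pow, ← Finset.mul_sum, hn, mul_one]
  rw [h3, mul_one] at h2
  rw [← Fintype.sum_prod_type' fun j k => ‖E j k‖ ^ 2]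
  exact (pow_le_pow_left₀ (norm_nonneg _) h1 2).trans h2

variable {X : Matrix (Fin n) (Fin n) ℂ} {x : EuclideanSpace ℂ (Fin n)}

theorem isHermitian_lift (x : EuclideanSpace ℂ (Fin n)) : (lift x).IsHermitian := by
  ext j k
  simp [lift, Matrix.vecMulVec_apply, mul_comm]

theorem quadForm_nonneg_of_posSemidef (hX : X.PosSemidef) (a : EuclideanSpace ℂ (Fin n)) :
    0 ≤ quadForm X a := by
  rw [quadForm_eq_sum_eigenvalues hX.1]
  exact Finset.sum_nonneg fun k _ => mul_nonneg (hX.eigenvalues_nonneg k) (sq_nonneg _)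

theorem quadForm_sub_lift_nonneg (hX : X.PosSemidef) {a : EuclideanSpace ℂ (Fin n)}
    (ha : inner ℂ x a = 0) : 0 ≤ quadForm (X - lift x) a := by
  rw [quadForm_sub, quadForm_lift, norm_inner_symm, ha]
  simpa using quadForm_nonneg_of_posSemidef hX a

/-- A positive semidefinite matrix minus a rank one matrix has at most one negative eigenvalue:
two eigenvectors span a plane, which meets the orthogonal complement of `x`. -/
theorem eigenvalues_nonneg_of_ne (hX : X.PosSemidef) (hH : (X - lift x).IsHermitian) {i j : Fin n}
    (hij : i ≠ j) (hi : hH.eigenvalues i < 0) : 0 ≤ hH.eigenvalues j := by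
  by_contra! hj
  set α := inner ℂ x (hH.eigenvectorBasis j) with hα
  have h := quadForm_sub_lift_nonneg (x := x) hX
    (a := α • hH.eigenvectorBasis i - inner ℂ x (hH.eigenvectorBasis i) • hH.eigenvectorBasis j)
    (by rw [inner_sub_right, inner_smul_right, inner_smul_right, ← hα]; ring)
  rw [quadForm_smul_eigenvector_sub hH hij] at h
  have hα0 : α ≠ 0 := fun h0 => by
    have := quadForm_sub_lift_nonneg (x := x) hX h0
    rw [quadForm_eigenvectorBasis] at this
    linarith
  have : 0 < ‖α‖ ^ 2 := by positivity
  nlinarith [sq_nonneg ‖inner ℂ x (hH.eigenvectorBasis i)‖]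

theorem trace_ge_or_exists_eigenvalue_le (hX : X.PosSemidef) (hH : (X - lift x).IsHermitian) :
    (∑ k, |hH.eigenvalues k|) / 3 ≤ ∑ k, hH.eigenvalues k ∨
      ∃ k, hH.eigenvalues k ≤ -((∑ k, |hH.eigenvalues k|) / 3) := by
  by_cases hneg : ∃ k, hH.eigenvalues k < 0
  · obtain ⟨k, hk⟩ := hneg
    have h1 : ∑ l, |hH.eigenvalues l| = ∑ l, hH.eigenvalues l - 2 * hH.eigenvalues k := by
      rw [← Finset.add_sum_erase _ _ (Finset.mem_univ k),
        ← Finset.add_sum_erase Finset.univ hH.eigenvalues (Finset.mem_univ k), abs_of_neg hk,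
        Finset.sum_congr rfl fun l hl => abs_of_nonneg
          (eigenvalues_nonneg_of_ne hX hH (Finset.ne_of_mem_erase hl).symm hk)]
      ring
    rcases le_or_gt (hH.eigenvalues k) (-((∑ k, |hH.eigenvalues k|) / 3)) with h | h
    · exact Or.inr ⟨k, h⟩
    · left; linarith
  · push Not at hneg
    left
    rw [Finset.sum_congr rfl fun k _ => abs_of_nonneg (hneg k)]
    have := Finset.sum_nonneg fun k (_ : k ∈ Finset.univ) => hneg k
    linarith

theorem sum_re_diag_eq_sum_eigenvalues {H : Matrix (Fin n) (Fin n) ℂ} (hH : H.IsHermitian) :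
    ∑ j, (H j j).re = ∑ k, hH.eigenvalues k := by
  have h := congrArg Complex.re hH.trace_eq_sum_eigenvalues
  simpa [Matrix.trace] using h

/-- The Frobenius norm dominates the negative eigenvalue, so the weight `κ` on the diagonal
suffices to control the trace norm. -/
theorem sq_sum_abs_eigenvalues_le (hX : X.PosSemidef) (hH : (X - lift x).IsHermitian)
    (hre : ∀ j k, ((X - lift x) j k).im = 0) {κ : ℝ} (hκ0 : 0 ≤ κ) (hκ1 : κ ≤ 1) :
    κ / 16 * (∑ k, |hH.eigenvalues k|) ^ 2 ≤ (∑ j, ((X - lift x) j j).re) ^ 2 +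
      ∑ j, ∑ k, (if j = k then κ else 1) * ((X - lift x) j k).re ^ 2 := by
  set N := ∑ k, |hH.eigenvalues k|
  have hN : 0 ≤ N := Finset.sum_nonneg fun k _ => abs_nonneg _
  have hF : κ * ∑ j, ∑ k, ((X - lift x) j k).re ^ 2 ≤
      ∑ j, ∑ k, (if j = k then κ else 1) * ((X - lift x) j k).re ^ 2 := by
    rw [Finset.mul_sum]
    refine Finset.sum_le_sum fun j _ => ?_
    rw [Finset.mul_sum]
    refine Finset.sum_le_sum fun k _ => mul_le_mul_of_nonneg_right ?_ (sq_nonneg _)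
    split_ifs <;> linarith
  have hF0 : 0 ≤ ∑ j, ∑ k, ((X - lift x) j k).re ^ 2 :=
    Finset.sum_nonneg fun j _ => Finset.sum_nonneg fun k _ => sq_nonneg _
  have hκF := mul_nonneg hκ0 hF0
  rcases trace_ge_or_exists_eigenvalue_le hX hH with h | ⟨k, hk⟩
  · rw [← sum_re_diag_eq_sum_eigenvalues hH] at h
    have h2 : (N / 3) ^ 2 ≤ (∑ j, ((X - lift x) j j).re) ^ 2 := by gcongr
    nlinarith [sq_nonneg N]
  · have h1 := norm_sum_sq_le (E := X - lift x) (hH.eigenvectorBasis.orthonormal.1 k)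
    rw [← inner_toEuclideanLin_eq_sum] at h1
    have h2 := Complex.abs_re_le_norm (inner ℂ (hH.eigenvectorBasis k)
      (Matrix.toEuclideanLin (X - lift x) (hH.eigenvectorBasis k)))
    rw [← quadForm_eq_inner, quadForm_eigenvectorBasis] at h2
    have h3 : N / 3 ≤ |hH.eigenvalues k| := by
      rw [abs_of_nonpos (by linarith)]; linarith
    have h4 : (N / 3) ^ 2 ≤ ‖inner ℂ (hH.eigenvectorBasis k)
      (Matrix.toEuclideanLin (X - lift x) (hH.eigenvectorBasis k))‖ ^ 2 := by
      gcongr; exact h3.trans h2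
    have h5 : ∑ j, ∑ k, ‖(X - lift x) j k‖ ^ 2 = ∑ j, ∑ k, ((X - lift x) j k).re ^ 2 := by
      refine Finset.sum_congr rfl fun j _ => Finset.sum_congr rfl fun k _ => ?_
      rw [← Complex.normSq_eq_norm_sq, Complex.normSq_apply, hre]
      ring
    rw [h5] at h1
    have h6 : κ * (N / 3) ^ 2 ≤ κ * ∑ j, ∑ k, ((X - lift x) j k).re ^ 2 :=
      mul_le_mul_of_nonneg_left (h4.trans h1) hκ0
    nlinarith [sq_nonneg (∑ j, ((X - lift x) j j).re), mul_nonneg hκ0 (sq_nonneg N)]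

/-- The diagonal of `X - x x*` is almost nonnegative if `x` is flat: the standard basis vectors
are almost orthogonal to `x`. -/
theorem neg_le_re_diag_of_flat (hX : X.PosSemidef) (hH : (X - lift x).IsHermitian)
    (hx : x ∈ flatSignals n (1 / 81)) (j : Fin n) :
    -(1 / 40 * ∑ k, |hH.eigenvalues k|) ≤ ((X - lift x) j j).re := by
  set N := ∑ k, |hH.eigenvalues k|
  have hN : 0 ≤ N := Finset.sum_nonneg fun k _ => abs_nonneg _
  obtain ⟨hx0, hflat⟩ := hx
  have hxn : 0 < ‖x‖ := norm_pos_iff.2 hx0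
  set e : EuclideanSpace ℂ (Fin n) := EuclideanSpace.single j 1 with he
  set w : EuclideanSpace ℂ (Fin n) := (inner ℂ x e / (‖x‖ : ℂ) ^ 2) • x with hw
  have hen : ‖e‖ = 1 := by simp [he]
  have hwn : ‖w‖ ≤ 1 / 81 := by
    have h1 : ‖inner ℂ x e‖ ≤ 1 / 81 * ‖x‖ := by
      have : ‖inner ℂ x e‖ = ‖x.ofLp j‖ := by
        rw [he, EuclideanSpace.inner_single_right]; simp
      rw [this]
      exact (norm_le_pi_norm x.ofLp j).trans hflat
    rw [hw, norm_smul, norm_div, norm_pow, Complex.norm_real, norm_norm, div_mul_eq_mul_div,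
      div_le_iff₀ (by positivity)]
    nlinarith
  have horth : inner ℂ x (e - w) = 0 := by
    rw [inner_sub_right, hw, inner_smul_right, inner_self_eq_norm_sq_to_K]
    have : (‖x‖ : ℂ) ≠ 0 := by exact_mod_cast hxn.ne'
    simp only [Complex.coe_algebraMap]
    field_simp
    ring
  have hq := quadForm_sub_lift_nonneg (x := x) hX horth
  rw [quadForm_eq_inner, map_sub, inner_sub_left, inner_sub_right, inner_sub_right] at hq
  have hee : (inner ℂ e (Matrix.toEuclideanLin (X - lift x) e)).re = ((X - lift x) j j).re := by
    rw [he, EuclideanSpace.inner_single_left]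
    generalize X - lift x = H
    simp [Matrix.toLpLin_apply]
  have b1 := (Complex.abs_re_le_norm _).trans (norm_inner_toEuclideanLin_le hH e w)
  have b2 := (Complex.abs_re_le_norm _).trans (norm_inner_toEuclideanLin_le hH w e)
  have b3 := (Complex.abs_re_le_norm _).trans (norm_inner_toEuclideanLin_le hH w w)
  rw [hen] at b1 b2
  rw [Complex.sub_re, Complex.sub_re, Complex.sub_re, hee] at hq
  have c1 : N * (1 * ‖w‖) ≤ N * (1 * (1 / 81)) := by gcongr
  have c3 : N * (‖w‖ * ‖w‖) ≤ N * (1 / 81 * (1 / 81)) := by gcongr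
  have d1 := neg_le_of_abs_le (b1.trans c1)
  have d2 := neg_le_of_abs_le (b2.trans ((mul_comm ‖w‖ 1 ▸ c1)))
  have d3 := le_of_abs_le (b3.trans c3)
  linarith

/-- For flat `x` the trace and the off-diagonal part alone control the trace norm. -/
theorem sq_sum_abs_eigenvalues_le_of_flat (hX : X.PosSemidef) (hH : (X - lift x).IsHermitian)
    (hre : ∀ j k, ((X - lift x) j k).im = 0) (hx : x ∈ flatSignals n (1 / 81)) :
    1 / 16 * (∑ k, |hH.eigenvalues k|) ^ 2 ≤ (∑ j, ((X - lift x) j j).re) ^ 2 +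
      ∑ j, ∑ k, (if j = k then 0 else 1) * ((X - lift x) j k).re ^ 2 := by
  set H := X - lift x with hHdef
  have hdiag := neg_le_re_diag_of_flat hX hH hx
  set N := ∑ k, |hH.eigenvalues k|
  have hN : 0 ≤ N := Finset.sum_nonneg fun k _ => abs_nonneg _
  have hF0 : 0 ≤ ∑ j, ∑ k, (if j = k then (0 : ℝ) else 1) * (H j k).re ^ 2 :=
    Finset.sum_nonneg fun j _ => Finset.sum_nonneg fun k _ =>
      mul_nonneg (by split_ifs <;> norm_num) (sq_nonneg _)
  rcases trace_ge_or_exists_eigenvalue_le hX hH with h | ⟨i, hi⟩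
  · rw [← sum_re_diag_eq_sum_eigenvalues hH] at h
    have h2 : (N / 3) ^ 2 ≤ (∑ j, (H j j).re) ^ 2 := by gcongr
    nlinarith [sq_nonneg N]
  · set v := hH.eigenvectorBasis i
    have hv : ‖v‖ = 1 := hH.eigenvectorBasis.orthonormal.1 i
    have hvn : ∑ j, ‖v j‖ ^ 2 = 1 := by rw [← EuclideanSpace.norm_sq_eq, hv, one_pow]
    let E : Fin n → Fin n → ℂ := fun j k => if j = k then 0 else H j k
    have hsplit : ∑ j, ∑ k, star (v j) * H j k * v k =
        ∑ j, star (v j) * H j j * v j + ∑ j, ∑ k, star (v j) * E j k * v k := by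
      rw [← Finset.sum_add_distrib]
      refine Finset.sum_congr rfl fun j _ => ?_
      rw [← Finset.add_sum_erase _ _ (Finset.mem_univ j),
        ← Finset.add_sum_erase Finset.univ (fun k => star (v j) * E j k * v k) (Finset.mem_univ j)]
      simp only [E, if_true, mul_zero, zero_mul, zero_add]
      congr 1
      refine Finset.sum_congr rfl fun k hk => ?_
      rw [if_neg (Finset.ne_of_mem_erase hk).symm]
    have hd : -(1 / 40 * N) ≤ (∑ j, star (v j) * H j j * v j).re := by
      have hN' : -(1 / 40 * N) = ∑ j, -(1 / 40 * N) * ‖v j‖ ^ 2 := by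
        rw [← Finset.mul_sum, hvn, mul_one]
      rw [Complex.re_sum, hN']
      refine Finset.sum_le_sum fun j _ => ?_
      have : (star (v j) * H j j * v j).re = (H j j).re * ‖v j‖ ^ 2 := by
        rw [mul_right_comm, ← starRingEnd_apply, ← Complex.normSq_eq_conj_mul_self,
          Complex.re_ofReal_mul, Complex.normSq_eq_norm_sq, mul_comm]
      rw [this]
      exact mul_le_mul_of_nonneg_right (hdiag j) (sq_nonneg _)
    have hev := quadForm_eigenvectorBasis hH i
    rw [quadForm_eq_sum, hsplit, Complex.add_re] at hev
    have hE := norm_sum_sq_le (E := E) hv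
    have hE2 : ∑ j, ∑ k, ‖E j k‖ ^ 2 =
        ∑ j, ∑ k, (if j = k then (0 : ℝ) else 1) * (H j k).re ^ 2 := by
      refine Finset.sum_congr rfl fun j _ => Finset.sum_congr rfl fun k _ => ?_
      simp only [E]
      split_ifs
      · simp
      · rw [← Complex.normSq_eq_norm_sq, Complex.normSq_apply, hre]
        ring
    rw [hE2] at hE
    have habs := neg_le_of_abs_le (Complex.abs_re_le_norm (∑ j, ∑ k, star (v j) * E j k * v k))
    have h4 : N / 4 ≤ ‖∑ j, ∑ k, star (v j) * E j k * v k‖ := by linarith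
    have h5 : (N / 4) ^ 2 ≤ ‖∑ j, ∑ k, star (v j) * E j k * v k‖ ^ 2 := by gcongr
    nlinarith [sq_nonneg (∑ j, (H j j).re)]

end Descent

/-! ### Consequences of subgaussianity -/

section SubgaussianVector

variable {Ω₀ : Type*} [MeasurableSpace Ω₀] {P₀ : Measure Ω₀}

theorem IsSubgaussian.exists_lt {X : Ω₀ → ℂ} {K K' : ℝ} (hX : IsSubgaussian X K P₀)
    (hK : K < K') (hK' : 0 < K') :
    ∃ t, 0 < t ∧ t < K' ∧ ∫⁻ ω, ENNReal.ofReal (Real.exp (‖X ω‖ ^ 2 / t ^ 2)) ∂P₀ ≤ 2 := by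
  have h : psiTwoNorm X P₀ < ENNReal.ofReal K' :=
    lt_of_le_of_lt hX ((ENNReal.ofReal_lt_ofReal_iff hK').2 hK)
  obtain ⟨_, ⟨t, ⟨ht0, ht⟩, rfl⟩, hlt⟩ := sInf_lt_iff.1 h
  exact ⟨t, ht0, (ENNReal.ofReal_lt_ofReal_iff hK').1 hlt, ht⟩

theorem IsSubgaussian.one_le [IsProbabilityMeasure P₀] {X : Ω₀ → ℂ} {K : ℝ}
    (hX : IsSubgaussian X K P₀) (h1 : ∫ ω, ‖X ω‖ ^ 2 ∂P₀ = 1) : 1 ≤ K := by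
  by_contra! hK
  obtain ⟨t, ht0, ht1, ht⟩ := hX.exists_lt hK one_pos
  have hI : Integrable (fun ω => ‖X ω‖ ^ 2) P₀ := by
    by_contra h
    rw [integral_undef h] at h1
    exact zero_ne_one h1
  have hI' : Integrable (fun ω => 1 + ‖X ω‖ ^ 2 / t ^ 2) P₀ :=
    (integrable_const _).add (hI.div_const _)
  have h2 : ENNReal.ofReal (∫ ω, (1 + ‖X ω‖ ^ 2 / t ^ 2) ∂P₀) ≤ 2 := by
    rw [ofReal_integral_eq_lintegral_ofReal hI' (ae_of_all _ fun ω => by positivity)]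
    refine (lintegral_mono fun ω => ENNReal.ofReal_le_ofReal ?_).trans ht
    rw [add_comm]
    exact Real.add_one_le_exp _
  rw [integral_add (integrable_const _) (hI.div_const _), integral_div, h1] at h2
  simp only [integral_const, probReal_univ, smul_eq_mul, mul_one] at h2
  have h3 : 1 + 1 / t ^ 2 ≤ 2 := by
    rw [← ENNReal.ofReal_le_ofReal_iff (by norm_num)]
    exact h2.trans_eq (by simp)
  have h4 : 1 < 1 / t ^ 2 := by
    rw [lt_div_iff₀ (by positivity)]
    nlinarith
  linarith

theorem IsSubgaussian.lintegral_exp_le {X : Ω₀ → ℂ} {K : ℝ} (hX : IsSubgaussian X K P₀)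
    (hK : 1 ≤ K) : ∫⁻ ω, ENNReal.ofReal (Real.exp (‖X ω‖ ^ 2 / (2 * K) ^ 2)) ∂P₀ ≤ 2 := by
  obtain ⟨t, ht0, htK, ht⟩ := hX.exists_lt (by linarith : K < 2 * K) (by linarith)
  refine (lintegral_mono fun ω => ENNReal.ofReal_le_ofReal ?_).trans ht
  gcongr

theorem integrable_norm_pow_four_of_lintegral_exp_le {X : Ω₀ → ℂ} (hX : Measurable X) {L : ℝ}
    (hL : 0 < L) (h : ∫⁻ ω, ENNReal.ofReal (Real.exp (‖X ω‖ ^ 2 / L ^ 2)) ∂P₀ ≤ 2) :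
    Integrable (fun ω => ‖X ω‖ ^ 4) P₀ := by
  have hI : Integrable (fun ω => Real.exp (‖X ω‖ ^ 2 / L ^ 2)) P₀ := by
    refine ⟨by fun_prop, ?_⟩
    rw [hasFiniteIntegral_iff_ofReal (ae_of_all _ fun _ => (Real.exp_pos _).le)]
    exact h.trans_lt (by simp)
  refine (hI.const_mul (2 * L ^ 4)).mono' (by fun_prop) (ae_of_all _ fun ω => ?_)
  have h1 := Real.pow_div_factorial_le_exp (x := ‖X ω‖ ^ 2 / L ^ 2) (by positivity) 2
  have h2 : ‖X ω‖ ^ 4 = 2 * L ^ 4 * ((‖X ω‖ ^ 2 / L ^ 2) ^ 2 / (Nat.factorial 2 : ℝ)) := by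
    simp [Nat.factorial]; field_simp
  rw [Real.norm_eq_abs, abs_of_nonneg (by positivity), h2]
  gcongr

theorem AreIndepCopies.map_eq_pi {n m : ℕ} {ζ : Ω₀ → EuclideanSpace ℂ (Fin n)} {Ω : Type*}
    [MeasurableSpace Ω] {P : Measure Ω} [IsProbabilityMeasure P]
    {ξ : Fin m → Ω → EuclideanSpace ℂ (Fin n)} (hξ : AreIndepCopies ξ P ζ P₀) :
    P.map (fun ω i => ξ i ω) = Measure.pi fun _ : Fin m => P₀.map ζ := by
  rw [(iIndepFun_iff_map_fun_eq_pi_map fun i => (hξ.measurable i).aemeasurable).1 hξ.indep]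
  congr 1
  ext1 i
  exact (hξ.identDistrib i).map_eq

variable [IsProbabilityMeasure P₀] {n : ℕ} {ζ : Ω₀ → EuclideanSpace ℂ (Fin n)} {K : ℝ}

theorem IsSubgaussianVector.le_integral_sq_quadForm (hζ : IsSubgaussianVector ζ K P₀)
    (hK : 1 ≤ K) {κ : ℝ} (hκ : ∀ j, 1 + κ ≤ ∫ ω, ‖ζ ω j‖ ^ 4 ∂P₀)
    {H : Matrix (Fin n) (Fin n) ℂ} (hH : H.IsHermitian) (hre : ∀ j k, (H j k).im = 0) :
    (∑ j, (H j j).re) ^ 2 + ∑ j, ∑ k, (if j = k then κ else 1) * (H j k).re ^ 2 ≤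
      ∫ ω, quadForm H (ζ ω) ^ 2 ∂P₀ := by
  have hm : ∀ j, Measurable fun ω => ζ ω j := fun j => by
    have := hζ.measurable
    fun_prop
  have h := le_integral_sq_sum hm hζ.indep hζ.identDistrib hζ.mean hζ.variance
    (fun j => integrable_norm_pow_four_of_lintegral_exp_le (hm j) (by linarith)
      ((hζ.subgaussian j).lintegral_exp_le hK)) hκ (h := fun j k => (H j k).re)
    fun j k => by rw [← hH.apply j k]; simp
  refine h.trans_eq (integral_congr_ae (ae_of_all _ fun ω => ?_))
  simp only [quadForm_eq_sum, Complex.re_sum]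
  congr 1
  refine Finset.sum_congr rfl fun j _ => Finset.sum_congr rfl fun k _ => ?_
  simp [hre]
  ring

/-! ### The uniform lower bound for the measurement operator -/

variable {Ω : Type*} [MeasurableSpace Ω] {P : Measure Ω} [IsProbabilityMeasure P] {m : ℕ}
  {ξ : Fin m → Ω → EuclideanSpace ℂ (Fin n)}

theorem continuous_quadForm_left (x : EuclideanSpace ℂ (Fin n)) :
    Continuous fun H : Matrix (Fin n) (Fin n) ℂ => quadForm H x := by
  unfold quadForm
  fun_prop

theorem measurable_quadForm (H : Matrix (Fin n) (Fin n) ℂ) : Measurable (quadForm H) := by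
  rw [funext (quadForm_eq_sum H)]
  fun_prop

theorem two_mul_le_integral_abs_of_le_integral_sq {μ : Measure (EuclideanSpace ℂ (Fin n))}
    [IsProbabilityMeasure μ] (hK : 0 < K)
    (hexp : ∀ v : EuclideanSpace ℂ (Fin n), ‖v‖ = 1 →
      ∫⁻ x, ENNReal.ofReal (Real.exp (‖inner ℂ v x‖ ^ 2 / (128 * K ^ 2))) ∂μ ≤ 2)
    {b : ℝ} (hb : 0 < b) {Y : EuclideanSpace ℂ (Fin n) → ℝ} (hY : Y ∈ unitForms n)
    (h2 : b ^ 4 / 16 ≤ ∫ x, Y x ^ 2 ∂μ) :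
    2 * (b ^ 5 / (2 ^ 21 * K ^ 3)) ≤ ∫ x, |Y x| ∂μ := by
  -- With this `t`, the sixth moment term is at most an eighth of the second moment term.
  have h := le_integral_abs_of_mem_unitForms (by positivity) hexp hY
    (t := 2 ^ 15 * K ^ 3 / b) (by positivity)
  have h3 : b ^ 4 / 16 / (2 ^ 15 * K ^ 3 / b) ≤ (∫ x, Y x ^ 2 ∂μ) / (2 ^ 15 * K ^ 3 / b) := by
    gcongr
  have e1 : b ^ 4 / 16 / (2 ^ 15 * K ^ 3 / b) = 2 ^ 2 * (b ^ 5 / (2 ^ 21 * K ^ 3)) := by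
    field_simp
    norm_num
  have e2 : 1440 * (128 * K ^ 2) ^ 6 / (2 ^ 15 * K ^ 3 / b) ^ 5 =
      1440 / 2 ^ 12 * (b ^ 5 / (2 ^ 21 * K ^ 3)) := by
    field_simp
    norm_num
  rw [e1] at h3
  rw [e2] at h
  have h5 : 0 < b ^ 5 / (2 ^ 21 * K ^ 3) := by positivity
  linarith

/-- With overwhelming probability the measurements of all Hermitian forms of trace norm one whose
second moment is at least `b ^ 4 / 16` have large `ℓ₁` norm. -/
theorem exists_measurableSet_forall_le_sum_abs (hζ : IsSubgaussianVector ζ K P₀)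
    (hξ : AreIndepCopies ξ P ζ P₀) (hK : 1 ≤ K) {b : ℝ} (hb0 : 0 < b) (hb1 : b ≤ 1)
    (hm : 2 ^ 74 * K ^ 20 * n ≤ m * b ^ 10) :
    ∃ E : Set Ω, MeasurableSet E ∧ 1 - 2 * Real.exp (-(m * b ^ 10 / (2 ^ 72 * K ^ 10))) ≤ P.real E ∧
      ∀ ω ∈ E, ∀ H : Matrix (Fin n) (Fin n) ℂ, quadForm H ∈ unitForms n →
        b ^ 4 / 16 ≤ ∫ ω, quadForm H (ζ ω) ^ 2 ∂P₀ →
        m * (b ^ 5 / (2 ^ 21 * K ^ 3)) ≤ ∑ i, |quadForm H (ξ i ω)| := by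
  have hK0 : 0 < K := by linarith
  set μ := P₀.map ζ with hμ
  have : IsProbabilityMeasure μ := Measure.isProbabilityMeasure_map hζ.measurable.aemeasurable
  set c := b ^ 5 / (2 ^ 21 * K ^ 3) with hc
  have hexp : ∀ v : EuclideanSpace ℂ (Fin n), ‖v‖ = 1 →
      ∫⁻ x, ENNReal.ofReal (Real.exp (‖inner ℂ v x‖ ^ 2 / (128 * K ^ 2))) ∂μ ≤ 2 := by
    intro v hv
    rw [hμ, lintegral_map (by fun_prop) hζ.measurable]
    have h := lintegral_exp_norm_sq_inner_le hζ.measurable hζ.indep hζ.mean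
      (by linarith : 0 < 2 * K) (fun j => (hζ.subgaussian j).lintegral_exp_le hK) hv
    have e : 32 * (2 * K) ^ 2 = 128 * K ^ 2 := by ring
    rwa [e] at h
  let T : Set (Matrix (Fin n) (Fin n) ℂ) := {H | quadForm H ∈ unitForms n ∧
    b ^ 4 / 16 ≤ ∫ x, quadForm H x ^ 2 ∂μ}
  have : SecondCountableTopology (Matrix (Fin n) (Fin n) ℂ) :=
    inferInstanceAs (SecondCountableTopology (Fin n → Fin n → ℂ))
  obtain ⟨D, hDc, hDd⟩ := TopologicalSpace.exists_countable_dense T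
  have : Countable D := hDc.to_subtype
  have hmeas : ∀ H : Matrix (Fin n) (Fin n) ℂ, Measurable fun ω => ∑ i, |quadForm H (ξ i ω)| :=
    fun H => Finset.measurable_fun_sum _ fun i _ =>
      ((measurable_quadForm H).comp (hξ.measurable i)).norm
  set E : Set Ω := {ω | ∀ H : D, m * c ≤ ∑ i, |quadForm (H : T).1 (ξ i ω)|} with hE
  have hEm : MeasurableSet E := by
    rw [hE, Set.ofPred_forall]
    exact MeasurableSet.iInter fun H => measurableSet_le measurable_const (hmeas _)
  refine ⟨E, hEm, ?_, ?_⟩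
  · have hbad := measure_exists_sum_abs_lt_le (μ := μ) (R := 128 * K ^ 2) (by positivity) hexp
      (Y := fun H : D => quadForm (H : T).1) (fun H => (H : T).2.1) (b := c) (by positivity)
      (by
        rw [hc, div_le_iff₀ (by positivity)]
        have h1 : b ^ 5 ≤ 1 := pow_le_one₀ hb0.le hb1
        have h2 : 1 ≤ K ^ 5 := one_le_pow₀ hK
        nlinarith)
      (fun H => two_mul_le_integral_abs_of_le_integral_sq hK0 hexp hb0 (H : T).2.1 (H : T).2.2) m
    rw [← hξ.map_eq_pi, Measure.map_apply (measurable_pi_lambda _ hξ.measurable)] at hbad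
    · have hcompl : (fun ω i => ξ i ω) ⁻¹' {x | ∃ H : D, ∑ i, |quadForm (H : T).1 (x i)| < m * c} =
          Eᶜ := by
        ext ω
        simp [hE]
      rw [hcompl] at hbad
      have hreal : P.real Eᶜ ≤ 2 * Real.exp (-(m * b ^ 10 / (2 ^ 72 * K ^ 10))) := by
        refine (ENNReal.toReal_le_of_le_ofReal (by positivity) hbad).trans ?_
        rw [mul_assoc]
        refine mul_le_mul_of_nonneg_left ?_ (by norm_num)
        -- The cardinality of the net is absorbed into half of the exponent.
        have h25 : (25 : ℝ) ^ n ≤ Real.exp (4 * n) := by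
          rw [mul_comm, Real.exp_nat_mul]
          gcongr
          have := Real.add_one_le_exp (2 : ℝ)
          have h2 := Real.quadratic_le_exp_of_nonneg (by norm_num : (0 : ℝ) ≤ 4)
          have h4 : Real.exp 4 = Real.exp 2 * Real.exp 2 := by rw [← Real.exp_add]; norm_num
          have h3 := Real.quadratic_le_exp_of_nonneg (by norm_num : (0 : ℝ) ≤ 2)
          nlinarith
        refine (mul_le_mul_of_nonneg_right h25 (Real.exp_pos _).le).trans ?_
        rw [← Real.exp_add, Real.exp_le_exp]
        have e1 : m * c ^ 2 / (32768 * (128 * K ^ 2) ^ 2) =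
            2 * (m * b ^ 10 / (2 ^ 72 * K ^ 10)) := by
          rw [hc]; field_simp; ring
        have h4 : 4 * (n : ℝ) ≤ m * b ^ 10 / (2 ^ 72 * K ^ 10) := by
          rw [le_div_iff₀ (by positivity)]
          have h1 : K ^ 10 ≤ K ^ 20 := pow_le_pow_right₀ hK (by norm_num)
          have hn : (0 : ℝ) ≤ n := Nat.cast_nonneg n
          nlinarith [mul_le_mul_of_nonneg_left h1 hn]
        rw [e1]
        linarith
      rw [probReal_compl_eq_one_sub hEm] at hreal
      linarith
    · rw [Set.ofPred_exists]
      refine MeasurableSet.iUnion fun H => measurableSet_lt ?_ measurable_const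
      exact Finset.measurable_fun_sum _ fun i _ =>
        ((measurable_quadForm _).comp (measurable_pi_apply i)).norm
  · intro ω hω H hH1 hH2
    have hHT : H ∈ T := by
      refine ⟨hH1, ?_⟩
      rw [hμ, integral_map hζ.measurable.aemeasurable
        ((measurable_quadForm H).pow_const 2).aestronglyMeasurable]
      exact hH2
    have hcl : IsClosed {H : T | m * c ≤ ∑ i, |quadForm H.1 (ξ i ω)|} := by
      refine isClosed_le continuous_const (continuous_finsetSum _ fun i _ => ?_)
      exact ((continuous_quadForm_left _).comp continuous_subtype_val).abs
    have hsub : D ⊆ {H : T | m * c ≤ ∑ i, |quadForm H.1 (ξ i ω)|} := fun H hH => hω ⟨H, hH⟩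
    have := hcl.closure_subset_iff.2 hsub (hDd.closure_eq ▸ Set.mem_univ (⟨H, hHT⟩ : T))
    exact this

theorem quadForm_smul_mem_unitForms {H : Matrix (Fin n) (Fin n) ℂ} (hH : H.IsHermitian)
    (hN : 0 < ∑ k, |hH.eigenvalues k|) :
    quadForm ((∑ k, |hH.eigenvalues k|)⁻¹ • H) ∈ unitForms n := by
  refine ⟨fun k => (∑ k, |hH.eigenvalues k|)⁻¹ * hH.eigenvalues k, hH.eigenvectorBasis,
    hH.eigenvectorBasis.orthonormal.1, ?_, fun x => ?_⟩
  · simp only [abs_mul, abs_inv, abs_of_pos hN, ← Finset.mul_sum]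
    exact inv_mul_cancel₀ hN.ne'
  · rw [quadForm_smul, quadForm_eq_sum_eigenvalues hH, Finset.mul_sum]
    exact Finset.sum_congr rfl fun k _ => by ring

/-- The measurements of the error of a solution are bounded by the noise, since `x₀ x₀*` is feasible
and has residual `w`. -/
theorem sum_abs_quadForm_sub_lift_le {a : Fin m → EuclideanSpace ℂ (Fin n)}
    {x₀ : EuclideanSpace ℂ (Fin n)} (hx : x₀ ∈ realSignals n) {w : Fin m → ℝ}
    {X : Matrix (Fin n) (Fin n) ℂ} (hX : IsRealPhaseLiftSolution a (observations a x₀ w) X) :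
    ∑ i, |quadForm (X - lift x₀) (a i)| ≤ 2 * l1Norm w := by
  have hlift : lift x₀ ∈ realPSD n := by
    refine ⟨Matrix.posSemidef_vecMulVec_self_star _, fun j k => ?_⟩
    simp [lift, Matrix.vecMulVec_apply, hx j, hx k]
  have hmin : l1Norm (measOp a X - observations a x₀ w) ≤
      l1Norm (measOp a (lift x₀) - observations a x₀ w) := hX.2 hlift
  have hr : l1Norm (measOp a (lift x₀) - observations a x₀ w) = l1Norm w := by
    refine Finset.sum_congr rfl fun i _ => ?_
    have : measOp a (lift x₀) i = ‖inner ℂ (a i) x₀‖ ^ 2 := quadForm_lift x₀ (a i)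
    rw [Pi.sub_apply, this, observations, sub_add_cancel_left, abs_neg]
  have htri : ∑ i, |quadForm (X - lift x₀) (a i)| ≤
      l1Norm (measOp a X - observations a x₀ w) + l1Norm w := by
    rw [l1Norm, l1Norm, ← Finset.sum_add_distrib]
    refine Finset.sum_le_sum fun i _ => ?_
    have e : quadForm (X - lift x₀) (a i) =
        (measOp a X - observations a x₀ w) i + w i := by
      have : measOp a X i = quadForm X (a i) := rfl
      rw [quadForm_sub, quadForm_lift, Pi.sub_apply, this, observations]
      ring
    rw [e]
    exact abs_add_le _ _
  linarith

/-- The recovery guarantee for all signals whose descent directions have second moment at least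
`b ^ 4 / 16` times the squared trace norm. -/
theorem exists_measurableSet_forall_schattenOneNorm_le (hζ : IsSubgaussianVector ζ K P₀)
    (hξ : AreIndepCopies ξ P ζ P₀) (hK : 1 ≤ K) (hn : 0 < n) {b : ℝ} (hb0 : 0 < b) (hb1 : b ≤ 1)
    (hm : 2 ^ 74 * K ^ 20 * n ≤ m * b ^ 10) {S : Set (EuclideanSpace ℂ (Fin n))}
    (hSr : S ⊆ realSignals n)
    (hS : ∀ x₀ ∈ S, ∀ X ∈ realPSD n, ∀ hH : (X - lift x₀).IsHermitian,
      b ^ 4 / 16 * (∑ k, |hH.eigenvalues k|) ^ 2 ≤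
        ∫ ω, quadForm (X - lift x₀) (ζ ω) ^ 2 ∂P₀) :
    ∃ E : Set Ω, MeasurableSet E ∧ 1 - 2 * Real.exp (-(m * b ^ 10 / (2 ^ 72 * K ^ 10))) ≤ P.real E ∧
      ∀ ω ∈ E, ∀ x₀ ∈ S, ∀ w : Fin m → ℝ, ∀ X : Matrix (Fin n) (Fin n) ℂ,
        IsRealPhaseLiftSolution (fun i => ξ i ω) (observations (fun i => ξ i ω) x₀ w) X →
        schattenOneNorm (X - lift x₀) ≤ 2 ^ 22 * K ^ 3 / (m * b ^ 5) * l1Norm w := by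
  obtain ⟨E, hEm, hEP, hE⟩ := exists_measurableSet_forall_le_sum_abs hζ hξ hK hb0 hb1 hm
  refine ⟨E, hEm, hEP, fun ω hω x₀ hx₀ w X hX => ?_⟩
  have hm0 : (0 : ℝ) < m := by
    have h1 : (0 : ℝ) < n := by exact_mod_cast hn
    have h2 : 0 < 2 ^ 74 * K ^ 20 * n := by positivity
    exact pos_of_mul_pos_left (h2.trans_le hm) (by positivity)
  have hH : (X - lift x₀).IsHermitian := hX.1.1.1.sub (isHermitian_lift x₀)
  rw [schattenOneNorm_eq hH]
  set N := ∑ k, |hH.eigenvalues k| with hNdef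
  have hw : 0 ≤ l1Norm w := Finset.sum_nonneg fun i _ => abs_nonneg _
  have hN0 : 0 ≤ N := Finset.sum_nonneg fun k _ => abs_nonneg _
  rcases hN0.eq_or_lt with hN | hN
  · rw [← hN]
    positivity
  have hquad := hS x₀ hx₀ X hX.1 hH
  have hlow := hE ω hω (N⁻¹ • (X - lift x₀)) (quadForm_smul_mem_unitForms hH hN) (by
    simp only [quadForm_smul, mul_pow, integral_const_mul]
    rw [inv_pow, inv_mul_eq_div, le_div_iff₀ (by positivity)]
    exact hquad)
  have hup := sum_abs_quadForm_sub_lift_le (hSr hx₀) hX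
  simp only [quadForm_smul, abs_mul, abs_inv, abs_of_pos hN, ← Finset.mul_sum] at hlow
  rw [inv_mul_eq_div, le_div_iff₀ hN] at hlow
  have h := hlow.trans hup
  rw [div_mul_eq_mul_div, le_div_iff₀ (by positivity)]
  have e : m * (b ^ 5 / (2 ^ 21 * K ^ 3)) * N = N * (m * b ^ 5) / (2 ^ 21 * K ^ 3) := by ring
  rw [e, div_le_iff₀ (by positivity)] at h
  calc N * (m * b ^ 5) ≤ 2 * l1Norm w * (2 ^ 21 * K ^ 3) := h
    _ = _ := by ring

end SubgaussianVector

end PhaseLift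

open PhaseLift in
theorem theorem3p2 :
    ∃ C₀ C₁ C₂ C₃ : ℝ, 0 < C₀ ∧ 0 < C₁ ∧ 0 < C₂ ∧ 0 < C₃ ∧
      ∀ (n m : ℕ) (K : ℝ)
        (Ω₀ : Type*) [MeasurableSpace Ω₀] (P₀ : Measure Ω₀) [IsProbabilityMeasure P₀]
        (Ω : Type*) [MeasurableSpace Ω] (P : Measure Ω) [IsProbabilityMeasure P]
        (ζ : Ω₀ → EuclideanSpace ℂ (Fin n)) (ξ : Fin m → Ω → EuclideanSpace ℂ (Fin n)),
        IsSubgaussianVector ζ K P₀ → AreIndepCopies ξ P ζ P₀ →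
        (C₁ * K ^ 20 * n ≤ m →
          ∃ E : Set Ω, MeasurableSet E ∧
            1 - C₀ * Real.exp (-(m / (C₂ * K ^ 16))) ≤ P.real E ∧
            ∀ ω ∈ E, ∀ x₀ ∈ flatSignals n (1 / 81) ∩ realSignals n, ∀ w : Fin m → ℝ,
              ∀ X : Matrix (Fin n) (Fin n) ℂ,
                IsRealPhaseLiftSolution (fun i => ξ i ω)
                  (observations (fun i => ξ i ω) x₀ w) X →
                schattenOneNorm (X - lift x₀) ≤ C₃ * (K ^ 8 / m) * l1Norm w) ∧
        (∀ β : ℝ, 0 < β → β ≤ 1 →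
          (∀ j, 1 + β ≤ ∫ ω, ‖ζ ω j‖ ^ 4 ∂P₀) →
          C₁ * (K ^ 20 / β ^ (5 / 2 : ℝ)) * n ≤ m →
          ∃ E : Set Ω, MeasurableSet E ∧
            1 - C₀ * Real.exp (-(m * β ^ 4 / (C₂ * K ^ 16))) ≤ P.real E ∧
            ∀ ω ∈ E, ∀ x₀ ∈ realSignals n, x₀ ≠ 0 → ∀ w : Fin m → ℝ,
              ∀ X : Matrix (Fin n) (Fin n) ℂ,
                IsRealPhaseLiftSolution (fun i => ξ i ω)
                  (observations (fun i => ξ i ω) x₀ w) X →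
                schattenOneNorm (X - lift x₀)
                  ≤ C₃ * (K ^ 8 / (m * β ^ (5 / 2 : ℝ))) * l1Norm w) := by
  refine ⟨2, 2 ^ 74, 2 ^ 72, 2 ^ 22, by norm_num, by norm_num, by norm_num, by norm_num, ?_⟩
  intro n m K Ω₀ _ P₀ _ Ω _ P _ ζ ξ hζ hξ
  have hl1 : ∀ w : Fin m → ℝ, 0 ≤ l1Norm w := fun w => Finset.sum_nonneg fun i _ => abs_nonneg _
  rcases Nat.eq_zero_or_pos n with rfl | hn
  · -- There are no nonzero signals in dimension zero.
    refine ⟨fun _ => ⟨Set.univ, MeasurableSet.univ, ?_, fun ω _ x₀ hx₀ =>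
      absurd (Subsingleton.elim x₀ 0) hx₀.1.1⟩, fun β _ _ _ _ => ⟨Set.univ, MeasurableSet.univ, ?_,
      fun ω _ x₀ _ hx₀ => absurd (Subsingleton.elim x₀ 0) hx₀⟩⟩ <;>
    · rw [probReal_univ]
      exact sub_le_self _ (by positivity)
  have hK : 1 ≤ K := (hζ.subgaussian ⟨0, hn⟩).one_le (hζ.variance ⟨0, hn⟩)
  have hK0 : 0 < K := by linarith
  have hK16 : K ^ 10 ≤ K ^ 16 := pow_le_pow_right₀ hK (by norm_num)
  have hK8 : K ^ 3 ≤ K ^ 8 := pow_le_pow_right₀ hK (by norm_num)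
  have hre : ∀ x₀ ∈ realSignals n, ∀ X ∈ realPSD n, ∀ j k, ((X - lift x₀) j k).im = 0 := by
    intro x₀ hx X hX j k
    simp [lift, Matrix.vecMulVec_apply, hX.2 j k, hx j, hx k]
  refine ⟨fun hm => ?_, fun β hβ0 hβ1 hβ hm => ?_⟩
  · obtain ⟨E, hEm, hEP, hE⟩ := exists_measurableSet_forall_schattenOneNorm_le hζ hξ hK hn
      one_pos le_rfl (by simpa using hm) (S := flatSignals n (1 / 81) ∩ realSignals n)
      Set.inter_subset_right fun x₀ hx X hX hH => by
        have h4 : ∀ j, 1 + (0 : ℝ) ≤ ∫ ω, ‖ζ ω j‖ ^ 4 ∂P₀ := fun j => by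
          have hmj : Measurable fun ω => ζ ω j := by
            have := hζ.measurable
            fun_prop
          have h4i := integrable_norm_pow_four_of_lintegral_exp_le hmj
            (by linarith : 0 < 2 * K) ((hζ.subgaussian j).lintegral_exp_le hK)
          have h2i : Integrable (fun ω => ‖ζ ω j‖ ^ 2) P₀ := by
            by_contra h
            have := hζ.variance j
            rw [integral_undef h] at this
            exact zero_ne_one this
          -- `t ^ 2 ≥ 2 * t - 1` for `t = ‖ζ_j‖ ^ 2`, which has mean one.
          have := integral_mono ((h2i.const_mul 2).sub (integrable_const 1)) h4i fun ω => by
            simp only [Pi.sub_apply]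
            nlinarith [sq_nonneg (‖ζ ω j‖ ^ 2 - 1)]
          simp only [Pi.sub_apply] at this
          rw [integral_sub (h2i.const_mul 2) (integrable_const 1), integral_const_mul,
            hζ.variance] at this
          simp only [integral_const, probReal_univ, smul_eq_mul, mul_one] at this
          linarith
        rw [one_pow]
        exact (sq_sum_abs_eigenvalues_le_of_flat hX.1 hH (hre x₀ hx.2 X hX) hx.1).trans
          (hζ.le_integral_sq_quadForm hK h4 hH (hre x₀ hx.2 X hX))
    refine ⟨E, hEm, le_trans ?_ hEP, fun ω hω x₀ hx₀ w X hX => (hE ω hω x₀ hx₀ w X hX).trans ?_⟩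
    · rw [one_pow, mul_one]
      gcongr
    · have := hl1 w
      rw [one_pow, mul_one, mul_div_assoc]
      gcongr
  · set b : ℝ := β ^ (1 / 4 : ℝ) with hb
    have hb0 : 0 < b := Real.rpow_pos_of_pos hβ0 _
    have hb1 : b ≤ 1 := Real.rpow_le_one hβ0.le hβ1 (by norm_num)
    have hb4 : b ^ 4 = β := by
      rw [hb, ← Real.rpow_natCast, ← Real.rpow_mul hβ0.le]; norm_num
    have hb10 : β ^ (5 / 2 : ℝ) = b ^ 10 := by
      rw [hb, ← Real.rpow_natCast, ← Real.rpow_mul hβ0.le]; norm_num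
    rw [hb10] at hm ⊢
    obtain ⟨E, hEm, hEP, hE⟩ := exists_measurableSet_forall_schattenOneNorm_le hζ hξ hK hn
      hb0 hb1 (by
        rwa [← mul_div_assoc, div_mul_eq_mul_div, div_le_iff₀ (by positivity)] at hm)
      (S := realSignals n) subset_rfl fun x₀ hx X hX hH => by
        rw [hb4]
        exact (sq_sum_abs_eigenvalues_le hX.1 hH (hre x₀ hx X hX) hβ0.le hβ1).trans
          (hζ.le_integral_sq_quadForm hK hβ hH (hre x₀ hx X hX))
    refine ⟨E, hEm, le_trans ?_ hEP, fun ω hω x₀ hx₀ _ w X hX => (hE ω hω x₀ hx₀ w X hX).trans ?_⟩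
    · have h16 : β ^ 4 ≤ b ^ 10 := by
        rw [← hb4, ← pow_mul]
        exact pow_le_pow_of_le_one hb0.le hb1 (by norm_num)
      gcongr
    · have := hl1 w
      have h5 : b ^ 10 ≤ b ^ 5 := pow_le_pow_of_le_one hb0.le hb1 (by norm_num)
      rw [mul_div_assoc]
      rcases Nat.eq_zero_or_pos m with rfl | hm0
      · simp
      have : (0 : ℝ) < m := by exact_mod_cast hm0
      gcongr
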